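/- Let $\lambda\in(0,\tfrac12]$ and let $f:\mathbb R\to\mathbb R$ be of class $C^2$ with $f'(0)\ge 0$ and with $f''$ bounded and Lipschitz continuous on $\mathbb R$. For $p\ge 1$, let $W^{1,p}_{loc}([0,\infty))$ be the space of functions $v$ on $[0,\infty)$ that have a weak derivative $v'$ on $(0,\infty)$ and satisfy $v,v'\in L^p(0,R)$ for every $R>0$. Let $u_0\in W^{1,1/\lambda}_{loc}([0,\infty))$ (continuous representative) satisfy the compatibility condition $u_0(0)=0$ and $u_0'(0)=0$, the latter being the one-sided derivative at $0$. Consider, for $x,t>0$, the initial–boundary value problem $$u_{tx}+f'(u)\,u_{xx}+\lambda f''(u)\,(u_x)^2=0,\qquad u(0,t)=0,\qquad u(x,0)=u_0(x).\tag{$*$}$$ Then $(*)$ has a global weak solution, that is, there is a continuous function $u:[0,\infty)\times[0,\infty)\to\mathbb R$ such that 1. $u(0,t)=0$ for all $t\ge0$ and $u(x,0)=u_0(x)$ for all $x\ge0$; 2. for every $t\ge 0$, $u(\cdot,t)\in W^{1,1/\lambda}_{loc}([0,\infty))$, and $u(\cdot,t)$ is Hölder continuous with exponent $1-\lambda$ on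 every bounded interval $[0,R]$; 3. the weak derivative $u_x$ has a jointly measurable version on $(0,\infty)^2$ and, for every $\phi\in C^1_c((0,\infty)\times(0,\infty))$, the following integrand is integrable and $$\int_0^\infty\!\!\int_0^\infty\Big\{-u_x\,\big(\phi_t+f'(u)\,\phi_x\big)+(\lambda-1)\,f''(u)\,u_x^2\,\phi\Big\}\,dx\,dt=0 .$$ If moreover $\lambda\in(0,\tfrac13]\cup\{\tfrac12\}$, then $u$ can be chosen to be also locally Hölder continuous jointly in $x$ and $t$ with exponent $1-\lambda$: for every $R>0$ there is a constant $C$ such that $|u(x,t)-u(y,s)|\le C\,\max(|x-y|,|t-s|)^{1-\lambda}$ for all $(x,t),(y,s)\in[0,R]^2$. -/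

import Mathlib

open Set MeasureTheory
open scoped ContDiff

/-- Local `L^p` functions on the half-line `[0, ∞)`: `p`-integrable on each `[0, R]`. -/
def MemLpLocHalfLine (p : ℝ) (g : ℝ → ℝ) : Prop :=
  ∀ R : ℝ, MemLp g (ENNReal.ofReal p) (volume.restrict (Icc 0 R))

/-- `g` is the weak (distributional) derivative of `v` on `(0, ∞)`. -/
def IsWeakDerivHalfLine (v g : ℝ → ℝ) : Prop :=
  ∀ ψ : ℝ → ℝ, ContDiff ℝ ∞ ψ → HasCompactSupport ψ → tsupport ψ ⊆ Ioi 0 →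
    ∫ x in Ioi (0 : ℝ), v x * deriv ψ x = -∫ x in Ioi (0 : ℝ), g x * ψ x

/-- `g` is a weak derivative of `v` which witnesses that `v` belongs to the local Sobolev space
`W^{1,p}` of the half-line `[0, ∞)`. -/
def IsW1pLocDeriv (p : ℝ) (v g : ℝ → ℝ) : Prop :=
  MemLpLocHalfLine p v ∧ MemLpLocHalfLine p g ∧ IsWeakDerivHalfLine v g

/-- The local Sobolev space `W^{1,p}` of the half-line `[0, ∞)`. -/
def MemW1pLoc (p : ℝ) (v : ℝ → ℝ) : Prop :=
  ∃ g : ℝ → ℝ, IsW1pLocDeriv p v g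

/-- The open quarter plane, with points `(x, t)`. -/
def quarterPlane : Set (ℝ × ℝ) := Ioi 0 ×ˢ Ioi 0

/-- Test functions: `C¹` with compact support in the open quarter plane. -/
def IsTestFunction (φ : ℝ × ℝ → ℝ) : Prop :=
  ContDiff ℝ 1 φ ∧ HasCompactSupport φ ∧ tsupport φ ⊆ quarterPlane

/-- The integrand `-u_x (φ_t + f'(u) φ_x) + (lam - 1) f''(u) u_x² φ` of the weak formulation,
where `ux` stands for `u_x`. -/
noncomputable def weakIntegrand (lam : ℝ) (f : ℝ → ℝ) (u ux : ℝ → ℝ → ℝ) (φ : ℝ × ℝ → ℝ)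
    (z : ℝ × ℝ) : ℝ :=
  -ux z.1 z.2 * (deriv (fun s => φ (z.1, s)) z.2
      + deriv f (u z.1 z.2) * deriv (fun y => φ (y, z.2)) z.1)
    + (lam - 1) * deriv (deriv f) (u z.1 z.2) * (ux z.1 z.2) ^ 2 * φ z

/-- `u = u(x, t)` is a weak solution of
`u_{tx} + f'(u) u_{xx} + lam f''(u) u_x² = 0` in the quarter plane, with boundary values
`u(0, t) = 0` and initial values `u(x, 0) = u₀(x)`. Only the values of `u` on the closed quarter
plane matter. -/
structure IsWeakSolution (lam : ℝ) (f u₀ : ℝ → ℝ) (u : ℝ → ℝ → ℝ) : Prop where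
  /-- `u` is continuous up to the boundary, so that its boundary values are attained as limits. -/
  continuousOn : ContinuousOn (fun z : ℝ × ℝ => u z.1 z.2) (Ici 0 ×ˢ Ici 0)
  boundary : ∀ t : ℝ, 0 ≤ t → u 0 t = 0
  initial : ∀ x : ℝ, 0 ≤ x → u x 0 = u₀ x
  compatibility : u 0 0 = 0 ∧ HasDerivWithinAt (fun x => u x 0) 0 (Ici 0) 0
  sobolev : ∀ t : ℝ, 0 ≤ t → MemW1pLoc (1 / lam) (fun x => u x t)
  holder : ∀ t : ℝ, 0 ≤ t → ∀ R : ℝ, ∃ C : NNReal,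
    HolderOnWith C (Real.toNNReal (1 - lam)) (fun x => u x t) (Icc 0 R)
  /-- The equation, for a jointly measurable version `ux` of the weak derivative `u_x`. -/
  equation : ∃ ux : ℝ → ℝ → ℝ,
    AEStronglyMeasurable (fun z : ℝ × ℝ => ux z.1 z.2) (volume.restrict quarterPlane) ∧
    (∀ t : ℝ, 0 < t → IsW1pLocDeriv (1 / lam) (fun x => u x t) (fun x => ux x t)) ∧
    ∀ φ : ℝ × ℝ → ℝ, IsTestFunction φ →
      IntegrableOn (weakIntegrand lam f u ux φ) quarterPlane ∧
      ∫ z in quarterPlane, weakIntegrand lam f u ux φ z = 0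

/-- `u` is locally Hölder continuous, jointly in `x` and `t`, with exponent `r`, on the closed
quarter plane. -/
def LocallyHolderQuarterPlane (r : ℝ) (u : ℝ → ℝ → ℝ) : Prop :=
  ∀ R : ℝ, ∃ C : NNReal,
    HolderOnWith C (Real.toNNReal r) (fun z : ℝ × ℝ => u z.1 z.2) (Icc 0 R ×ˢ Icc 0 R)

open Filter Topology

/-! Put h = f'' and r = 1/λ ≥ 2. Along a characteristic x' = f'(u) the slope w = u_x obeys w' = -λ
h(u) w², which is linear for 1/w. Hence w = G/p with p = p₀ + λ G ∫ h(U) ds. The spacing of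
characteristics is X_ξ = |p|^r, and U_ξ = w X_ξ = G p |p|^(r-2). The last relation involves only U
and stays regular when p passes through 0, where w blows up. Since h is bounded and Lipschitz, it is
a fixed-point equation for a contraction in a weighted sup norm, globally in time
(`LagrangianData.exists_solution`).

To return to Eulerian variables, x = X(t, ξ) pushes |p|^r dξ forward to dx. From |U_ξ| ≤ X_ξ^(1-λ)
and Hölder's inequality (`abs_sub_space_le`), U is a function of X and is Hölder in it with exponent
1-λ. Since |G| ≤ 1, ∫ |u_x|^r dx is at most the length of the labels involved. The weak integrand,
pulled back, is an exact time derivative (`hasDerivAt_slope_mul_test`), so its integral vanishes.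

The obstacle is that X(t, ·) must remain onto: all characteristics may focus at one time (take h = 1
and a constant negative slope). The remedy is to insert fans, that is labels with p₀ = 0, which have
no width at time 0 and do not change the initial data. In the block [k, k+1] of labels, with m =
1/(k+1), the first half is a fan with G = m^λ and the second half carries ordinary characteristics.
Both halves see almost the same history ∫ h(U) ds. If it is large the fan has opened; if it is small
the ordinary part has not closed. So the block keeps at least 2^(1-r) times its initial width less
O(m²) (`le_charPos_block`). As Σ m² converges while Σ m diverges, the ordinary labels can cover the
half-line, parametrised by the energy ∫ (1 + |u₀'|)^r, and characteristics still escape to infinity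
at every time. Negative labels carry u = 0 and enter through x = 0 because f'(0) ≥ 0; this gives the
boundary condition. -/

/-! ### Calculus of |p|^r and p |p|^(r-2). -/

/-- The signed power `p |p|^(r-2)`, of absolute value `|p|^(r-1)`. -/
noncomputable def signedPow (r p : ℝ) : ℝ := p * |p| ^ (r - 2)

lemma continuous_abs_rpow {s : ℝ} (hs : 0 ≤ s) : Continuous fun p : ℝ => |p| ^ s :=
  continuous_abs.rpow_const fun _ => Or.inr hs

lemma continuous_signedPow {r : ℝ} (hr : 2 ≤ r) : Continuous (signedPow r) :=
  continuous_id.mul (continuous_abs_rpow (by linarith))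

lemma abs_signedPow {r : ℝ} (hr : 2 ≤ r) (p : ℝ) : |signedPow r p| = |p| ^ (r - 1) := by
  unfold signedPow
  rw [abs_mul, abs_of_nonneg (Real.rpow_nonneg (abs_nonneg p) _)]
  rw [show r - 1 = 1 + (r - 2) by ring, Real.rpow_one_add' (abs_nonneg p) (by linarith)]

lemma signedPow_of_nonneg {r p : ℝ} (hr : 2 ≤ r) (hp : 0 ≤ p) : signedPow r p = p ^ (r - 1) := by
  unfold signedPow
  rw [abs_of_nonneg hp, show r - 1 = 1 + (r - 2) by ring, Real.rpow_one_add' hp (by linarith)]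

lemma hasDerivAt_signedPow {r : ℝ} (hr : 2 ≤ r) (p : ℝ) :
    HasDerivAt (signedPow r) ((r - 1) * |p| ^ (r - 2)) p := by
  -- At `r = 2` the exponent `r - 2` is zero and `0 ^ 0 = 1`: the slope at the origin tends to 1
  -- instead of 0, so this case is separate.
  rcases hr.eq_or_lt with rfl | hr
  · have : signedPow 2 = fun p : ℝ => p := by ext p; simp [signedPow]
    rw [this]
    convert! hasDerivAt_id p using 1
    norm_num
  by_cases hp : p = 0
  · subst hp
    rw [hasDerivAt_iff_tendsto_slope]
    have h1 : Tendsto (fun p : ℝ => |p| ^ (r - 2)) (𝓝[≠] 0) (𝓝 0) := by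
      have := (continuous_abs_rpow (s := r - 2) (by linarith)).tendsto 0
      rw [abs_zero, Real.zero_rpow (by linarith)] at this
      exact this.mono_left nhdsWithin_le_nhds
    rw [abs_zero, Real.zero_rpow (by linarith), mul_zero]
    refine h1.congr' ?_
    filter_upwards [self_mem_nhdsWithin] with x hx
    have hx : x ≠ 0 := hx
    simp only [slope_def_field, signedPow, zero_mul, sub_zero]
    field_simp
  · have h1 : HasDerivAt (fun p : ℝ => |p|) (SignType.sign p : ℝ) p := hasDerivAt_abs hp
    have h2 := h1.rpow_const (p := r - 2) (Or.inl (abs_ne_zero.2 hp))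
    have h3 := (hasDerivAt_id p).mul h2
    convert! h3 using 1
    have h4 : |p| ^ (r - 2) = |p| * |p| ^ (r - 2 - 1) := by
      rw [← Real.rpow_one_add' (abs_nonneg p) (by linarith)]; ring_nf
    have h5 : p * (SignType.sign p : ℝ) = |p| := by
      rw [mul_comm]; exact sign_mul_self p
    simp only [id_eq, one_mul]
    have : p * ((SignType.sign p : ℝ) * (r - 2) * |p| ^ (r - 2 - 1)) = (r - 2) * |p| ^ (r - 2) := by
      rw [h4, ← h5]; ring
    rw [this]; ring

lemma abs_sub_le_of_hasDerivAt {F F' : ℝ → ℝ} {B C : ℝ} (hF : ∀ x, HasDerivAt F (F' x) x)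
    (hC : ∀ x, |x| ≤ B → |F' x| ≤ C) {a b : ℝ} (ha : |a| ≤ B) (hb : |b| ≤ B) :
    |F a - F b| ≤ C * |a - b| := by
  have := (convex_closedBall (0 : ℝ) B).norm_image_sub_le_of_norm_hasDerivWithin_le
    (f := F) (f' := F') (C := C) (x := b) (y := a)
    (fun x _ => (hF x).hasDerivWithinAt) (fun x hx => hC x (by simpa using hx))
    (by simpa using hb) (by simpa using ha)
  simpa using this

lemma abs_signedPow_sub_le {r B : ℝ} (hr : 2 ≤ r) {a b : ℝ} (ha : |a| ≤ B) (hb : |b| ≤ B) :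
    |signedPow r a - signedPow r b| ≤ (r - 1) * B ^ (r - 2) * |a - b| := by
  refine abs_sub_le_of_hasDerivAt (hasDerivAt_signedPow hr) (fun x hx => ?_) ha hb
  rw [abs_mul, abs_of_nonneg (by linarith : (0 : ℝ) ≤ r - 1),
    abs_of_nonneg (Real.rpow_nonneg (abs_nonneg x) _)]
  gcongr
  linarith

lemma hasDerivAt_abs_rpow' {r : ℝ} (hr : 2 ≤ r) (p : ℝ) :
    HasDerivAt (fun p : ℝ => |p| ^ r) (r * signedPow r p) p := by
  convert! hasDerivAt_abs_rpow p (by linarith : 1 < r) using 1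
  unfold signedPow; ring

lemma abs_rpow_sub_le {r B : ℝ} (hr : 2 ≤ r) {a b : ℝ} (ha : |a| ≤ B) (hb : |b| ≤ B) :
    |(|a| ^ r - |b| ^ r)| ≤ r * B ^ (r - 1) * |a - b| := by
  refine abs_sub_le_of_hasDerivAt (F := fun p : ℝ => |p| ^ r) (hasDerivAt_abs_rpow' hr)
    (fun x hx => ?_) ha hb
  rw [abs_mul, abs_of_nonneg (by linarith : (0 : ℝ) ≤ r), abs_signedPow hr]
  gcongr
  linarith

/-! ### Primitives of bounded functions and integration by parts. -/

/-- A primitive of a bounded function depending continuously on a parameter is jointly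
continuous. -/
lemma continuous_parametric_primitive {F : ℝ → ℝ → ℝ} {B : ℝ → ℝ}
    (hmeas : ∀ t, Measurable (F t)) (hcont : ∀ η, Continuous fun t => F t η)
    (hB : ∀ T t η, |t| ≤ T → |F t η| ≤ B T) :
    Continuous fun z : ℝ × ℝ => ∫ η in (0 : ℝ)..z.1, F z.2 η := by
  have key : Continuous fun z : ℝ × ℝ => ∫ η in (0 : ℝ)..z.2, F z.1 η := by
    refine continuous_iff_continuousAt.2 fun z => ?_
    obtain ⟨t, b⟩ := z
    refine intervalIntegral.continuousAt_parametric_primitive_of_dominated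
      (fun _ => B (|t| + 1)) (-|b| - 1) (|b| + 1)
      (fun x => (hmeas x).aestronglyMeasurable) ?_ (by simp)
      (Eventually.of_forall fun η => (hcont η).continuousAt)
      ⟨by linarith [abs_nonneg b], by positivity⟩ ⟨by linarith [neg_abs_le b], by
        linarith [le_abs_self b]⟩ (by simp)
    filter_upwards [Metric.ball_mem_nhds t one_pos] with x hx
    refine Eventually.of_forall fun η => hB _ _ _ ?_
    rw [Metric.mem_ball, Real.dist_eq] at hx
    linarith [abs_sub_abs_le_abs_sub x t]
  exact key.comp continuous_swap

lemma intervalIntegrable_of_bounded {h : ℝ → ℝ} {C : ℝ} (hm : Measurable h)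
    (hC : ∀ x, |h x| ≤ C) (a b : ℝ) : IntervalIntegrable h volume a b :=
  (intervalIntegrable_const (c := C)).mono_fun hm.aestronglyMeasurable
    (Eventually.of_forall fun x => by
      simpa using (hC x).trans (le_abs_self C))

lemma locallyIntegrable_of_bounded {h : ℝ → ℝ} {C : ℝ} (hm : Measurable h)
    (hC : ∀ x, |h x| ≤ C) : LocallyIntegrable h volume :=
  (locallyIntegrable_const C).mono hm.aestronglyMeasurable
    (Eventually.of_forall fun x => by
      simpa using (hC x).trans (le_abs_self C))

/-- A primitive of a bounded function is Lipschitz, so its image of `[a, b]` lies in a ball, on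
which a C¹ function is Lipschitz as well. -/
lemma absolutelyContinuous_comp {ψ V h : ℝ → ℝ} (hψ : ContDiff ℝ 1 ψ) {C : ℝ}
    (hC : ∀ x, |h x| ≤ C) (hV : ∀ a b, V b - V a = ∫ x in a..b, h x) (a b : ℝ) :
    AbsolutelyContinuousOnInterval (fun x => ψ (V x)) a b := by
  have hC0 : 0 ≤ C := (abs_nonneg _).trans (hC 0)
  have hVl : LipschitzWith C.toNNReal V := by
    refine LipschitzWith.of_dist_le_mul fun x y => ?_
    rw [Real.dist_eq, hV y x, Real.coe_toNNReal C hC0, Real.dist_eq]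
    simpa using intervalIntegral.norm_integral_le_of_norm_le_const (f := h) (a := y) (b := x)
      (C := C) (fun z _ => by simpa using hC z)
  obtain ⟨R, hR⟩ := (isCompact_uIcc (a := a) (b := b)).image hVl.continuous |>.isBounded
    |>.subset_closedBall 0
  obtain ⟨K, hK⟩ := (hψ.contDiffOn (s := Metric.closedBall 0 R)).exists_lipschitzOnWith
    (by simp) (convex_closedBall _ _) (isCompact_closedBall _ _)
  exact (hK.comp (hVl.lipschitzOnWith (s := uIcc a b))
    (fun x hx => hR (mem_image_of_mem _ hx))).absolutelyContinuousOnInterval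

lemma ae_hasDerivAt_primitive {V h : ℝ → ℝ} {C : ℝ} (hm : Measurable h)
    (hC : ∀ x, |h x| ≤ C) (hV : ∀ a b, V b - V a = ∫ x in a..b, h x) :
    ∀ᵐ x, HasDerivAt V (h x) x := by
  filter_upwards [_root_.LocallyIntegrable.ae_hasDerivAt_integral
    (locallyIntegrable_of_bounded hm hC)] with x hx
  have : V = fun y => (∫ t in (0 : ℝ)..y, h t) + V 0 := by
    ext y; rw [← hV]; ring
  rw [this]
  exact (hx 0).add_const _

/-- Integration by parts for primitives of bounded functions. -/
lemma integral_primitive_mul_comp {ψ V W h k : ℝ → ℝ} (hψ : ContDiff ℝ 1 ψ) {C D : ℝ}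
    (hm : Measurable h) (hC : ∀ x, |h x| ≤ C) (hV : ∀ a b, V b - V a = ∫ x in a..b, h x)
    (km : Measurable k) (kD : ∀ x, |k x| ≤ D) (hW : ∀ a b, W b - W a = ∫ x in a..b, k x)
    (a b : ℝ) :
    ∫ x in a..b, (k x * ψ (V x) + W x * (deriv ψ (V x) * h x))
      = W b * ψ (V b) - W a * ψ (V a) := by
  have hVa := absolutelyContinuous_comp hψ hC hV a b
  have hWa := absolutelyContinuous_comp contDiff_id kD hW a b
  have := hWa.integral_deriv_mul_eq_sub hVa
  simp only [id_eq] at this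
  rw [← this]
  refine intervalIntegral.integral_congr_ae ?_
  filter_upwards [ae_hasDerivAt_primitive hm hC hV, ae_hasDerivAt_primitive km kD hW]
    with x hx hx' _
  have h1 : HasDerivAt (fun x => ψ (V x)) (deriv ψ (V x) * h x) x :=
    ((hψ.differentiable (by simp)) (V x)).hasDerivAt.comp x hx
  rw [h1.deriv, hx'.deriv]

lemma integral_deriv_comp_primitive {ψ V h : ℝ → ℝ} (hψ : ContDiff ℝ 1 ψ) {C : ℝ}
    (hm : Measurable h) (hC : ∀ x, |h x| ≤ C) (hV : ∀ a b, V b - V a = ∫ x in a..b, h x)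
    (a b : ℝ) :
    ∫ x in a..b, deriv ψ (V x) * h x = ψ (V b) - ψ (V a) := by
  have := integral_primitive_mul_comp hψ hm hC hV (k := fun _ => 0) (W := fun _ => 1) (D := 0)
    measurable_const (by simp) (by simp) a b
  simpa using this

/-- A differentiable function has zero derivative at almost every zero. -/
lemma ae_deriv_eq_zero_of_eq_zero {p p' : ℝ → ℝ} (hp : ∀ t, HasDerivAt p (p' t) t) :
    ∀ᵐ t, p t = 0 → p' t = 0 := by
  -- A zero with nonzero derivative is isolated from the right in the zero set, and a set of reals
  -- has only countably many such points.
  have hc : {t ∈ {t | p t = 0} | 𝓝[{t | p t = 0} ∩ Ioi t] t = ⊥}.Countable :=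
    countable_setOfPred_isolated_right_within
  filter_upwards [hc.ae_notMem volume] with t ht h0
  by_contra hne
  refine ht ⟨h0, ?_⟩
  have h1 := (hp t).eventually_ne hne (c := 0)
  rw [nhdsWithin, inf_principal_eq_bot]
  rw [eventually_nhdsWithin_iff] at h1
  filter_upwards [h1] with s hs hs'
  exact hs (ne_of_gt hs'.2) hs'.1

/-! ### Monotone changes of variables. -/

/-- The largest preimage of `x` under a continuous monotone function. -/
noncomputable def monoInv (Z : ℝ → ℝ) (x : ℝ) : ℝ := sSup {s | Z s ≤ x}

section MonoInv

variable {Z : ℝ → ℝ} (hm : Monotone Z) (hc : Continuous Z) (ht : Tendsto Z atTop atTop)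
  (hb : Tendsto Z atBot atBot)
include hm hc ht hb

lemma apply_monoInv (x : ℝ) : Z (monoInv Z x) = x := by
  obtain ⟨s, hs⟩ := (hc.surjective ht hb) x
  have hne : {s | Z s ≤ x}.Nonempty := ⟨s, hs.le⟩
  obtain ⟨y, hy⟩ := (ht.eventually_gt_atTop x).exists
  have hbd : BddAbove {s | Z s ≤ x} := ⟨y, fun z hz => by
    by_contra! h
    exact absurd (hm h.le) (not_le.2 (lt_of_le_of_lt hz hy))⟩
  refine le_antisymm ?_ (hs.ge.trans (hm (le_csSup hbd hs.le)))
  exact (isClosed_Iic.preimage hc).csSup_mem hne hbd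

/-- This Galois connection, which relies on the choice of the largest preimage, reduces every
question on the inverse to one on `Z`. -/
lemma le_monoInv_iff {s x : ℝ} : s ≤ monoInv Z x ↔ Z s ≤ x := by
  refine ⟨fun h => (hm h).trans_eq (apply_monoInv hm hc ht hb x), fun h => ?_⟩
  obtain ⟨y, hy⟩ := (ht.eventually_gt_atTop x).exists
  exact le_csSup ⟨y, fun z (hz : Z z ≤ x) => by
    by_contra! h
    exact absurd (hm h.le) (not_le.2 (lt_of_le_of_lt hz hy))⟩ h

lemma monoInv_lt_iff {s x : ℝ} : monoInv Z x < s ↔ x < Z s := by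
  rw [← not_le, le_monoInv_iff hm hc ht hb, not_le]

lemma monotone_monoInv : Monotone (monoInv Z) := fun x y h => by
  rw [le_monoInv_iff hm hc ht hb, apply_monoInv hm hc ht hb]
  exact h

end MonoInv

/-- The measure with density `ρ`. -/
noncomputable def densMeasure (ρ : ℝ → ℝ) : Measure ℝ :=
  volume.withDensity fun s => ENNReal.ofReal (ρ s)

lemma densMeasure_Ioc {ρ : ℝ → ℝ} (hρ0 : ∀ s, 0 ≤ ρ s)
    (hi : ∀ a b, IntervalIntegrable ρ volume a b) {a b : ℝ} (hab : a ≤ b) :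
    densMeasure ρ (Ioc a b) = ENNReal.ofReal (∫ s in a..b, ρ s) := by
  rw [densMeasure, withDensity_apply _ measurableSet_Ioc, intervalIntegral.integral_of_le hab,
    ofReal_integral_eq_lintegral_ofReal]
  · exact (intervalIntegrable_iff_integrableOn_Ioc_of_le hab).1 (hi a b)
  · exact Eventually.of_forall hρ0

lemma continuous_of_primitive {ρ Z : ℝ → ℝ} (hi : ∀ a b, IntervalIntegrable ρ volume a b)
    (hZ : ∀ a b, Z b - Z a = ∫ s in a..b, ρ s) : Continuous Z := by
  have : Z = fun y => (∫ t in (0 : ℝ)..y, ρ t) + Z 0 := by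
    ext y; rw [← hZ]; ring
  rw [this]
  exact (intervalIntegral.continuous_primitive hi 0).add_const _

lemma monotone_of_primitive {ρ Z : ℝ → ℝ} (hρ0 : ∀ s, 0 ≤ ρ s)
    (hZ : ∀ a b, Z b - Z a = ∫ s in a..b, ρ s) : Monotone Z := fun a b hab => by
  rw [← sub_nonneg, hZ]
  exact intervalIntegral.integral_nonneg hab fun s _ => hρ0 s

section Pushforward

variable {ρ Z : ℝ → ℝ} (hρ0 : ∀ s, 0 ≤ ρ s)
  (hi : ∀ a b, IntervalIntegrable ρ volume a b) (hZ : ∀ a b, Z b - Z a = ∫ s in a..b, ρ s)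
  (ht : Tendsto Z atTop atTop) (hb : Tendsto Z atBot atBot)
include hρ0 hi hZ ht hb

/-- A monotone map with density `ρ` pushes `ρ ds` forward to Lebesgue measure. -/
lemma map_densMeasure : (densMeasure ρ).map Z = volume := by
  have hc := continuous_of_primitive hi hZ
  have hm := monotone_of_primitive hρ0 hZ
  have key : ∀ ⦃a b : ℝ⦄, a < b → (densMeasure ρ).map Z (Ioc a b) = volume (Ioc a b) := by
    intro a b hab
    rw [Measure.map_apply hc.measurable measurableSet_Ioc]
    -- Equality holds even when `Z` has flat pieces: with largest preimages, half-open intervals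
    -- pull back to half-open intervals.
    have : Z ⁻¹' Ioc a b = Ioc (monoInv Z a) (monoInv Z b) := by
      ext s
      simp only [mem_preimage, mem_Ioc, monoInv_lt_iff hm hc ht hb, le_monoInv_iff hm hc ht hb]
    rw [this, densMeasure_Ioc hρ0 hi (monotone_monoInv hm hc ht hb hab.le), ← hZ,
      apply_monoInv hm hc ht hb, apply_monoInv hm hc ht hb, Real.volume_Ioc]
  refine (Measure.ext_of_Ioc _ _ fun a b hab => (key hab).symm).symm

/-- Flat pieces of `Z` carry no density, since their image is a Lebesgue-null point. -/
lemma densMeasure_preimage_singleton (c : ℝ) : densMeasure ρ {s | Z s = c} = 0 := by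
  have hc := continuous_of_primitive hi hZ
  have := map_densMeasure hρ0 hi hZ ht hb
  have h2 : (densMeasure ρ).map Z {c} = 0 := by rw [this]; simp
  rwa [Measure.map_apply hc.measurable (measurableSet_singleton c)] at h2

/-- If `s` is not the largest preimage of its value, then `Z` is constant up to some rational to the
right of `s`. Countably many levels are involved, each of zero density. -/
lemma ae_monoInv_apply : ∀ᵐ s ∂(densMeasure ρ), monoInv Z (Z s) = s := by
  have hc := continuous_of_primitive hi hZ
  have hm := monotone_of_primitive hρ0 hZ
  have h : ∀ᵐ s ∂(densMeasure ρ), ∀ c : ℚ, Z s ≠ Z c :=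
    ae_all_iff.2 fun c => by
      rw [ae_iff]
      simpa using densMeasure_preimage_singleton hρ0 hi hZ ht hb (Z c)
  filter_upwards [h] with s hs
  refine le_antisymm ?_ ((le_monoInv_iff hm hc ht hb).2 le_rfl)
  by_contra! hlt
  obtain ⟨c, h1, h2⟩ := exists_rat_btwn hlt
  exact hs c (le_antisymm (hm h1.le) ((le_monoInv_iff hm hc ht hb).1 h2.le))

/-- `Ioc a b` and the preimage of `Ioc (Z a) (Z b)` differ only within the levels `Z a` and `Z b`,
which are null for the density. -/
lemma map_restrict_densMeasure (a b : ℝ) :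
    ((densMeasure ρ).restrict (Ioc a b)).map Z = volume.restrict (Ioc (Z a) (Z b)) := by
  have hc := continuous_of_primitive hi hZ
  have hm := monotone_of_primitive hρ0 hZ
  have h : (Ioc a b : Set ℝ) =ᵐ[densMeasure ρ] Z ⁻¹' (Ioc (Z a) (Z b)) := by
    have hne : ∀ c, ∀ᵐ s ∂(densMeasure ρ), Z s ≠ c := fun c => by
      rw [ae_iff]
      simpa using densMeasure_preimage_singleton hρ0 hi hZ ht hb c
    filter_upwards [hne (Z a), hne (Z b)] with s ha hb
    refine propext (⟨fun h => ⟨lt_of_le_of_ne (hm h.1.le) (Ne.symm ha), hm h.2⟩, fun h => ⟨?_, ?_⟩⟩)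
    · by_contra! h'
      exact absurd (hm h') (not_le.2 h.1)
    · by_contra! h'
      exact absurd (lt_of_le_of_ne h.2 hb) (not_lt.2 (hm h'.le))
  rw [Measure.restrict_congr_set h, ← Measure.restrict_map hc.measurable measurableSet_Ioc,
    map_densMeasure hρ0 hi hZ ht hb]

lemma lintegral_comp_mul_density (hρm : Measurable ρ) {F : ℝ → ENNReal} (hF : Measurable F) :
    ∫⁻ s, ENNReal.ofReal (ρ s) * F (Z s) = ∫⁻ x, F x := by
  have hc := continuous_of_primitive hi hZ
  conv_rhs => rw [← map_densMeasure hρ0 hi hZ ht hb]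
  rw [lintegral_map hF hc.measurable, densMeasure]
  exact (lintegral_withDensity_eq_lintegral_mul _ hρm.ennreal_ofReal
    (hF.comp hc.measurable)).symm

lemma integral_comp_mul_density (hρm : Measurable ρ) {F : ℝ → ℝ} (hF : Measurable F) :
    ∫ s, ρ s * F (Z s) = ∫ x, F x := by
  have hc := continuous_of_primitive hi hZ
  conv_rhs => rw [← map_densMeasure hρ0 hi hZ ht hb]
  rw [integral_map hc.aemeasurable hF.aestronglyMeasurable, densMeasure,
    integral_withDensity_eq_integral_toReal_smul hρm.ennreal_ofReal (by simp)]
  simp [ENNReal.toReal_ofReal (hρ0 _)]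

/-- Change of variables `x = Z s` for a monotone map with density `ρ`. -/
lemma intervalIntegral_comp_mul_density (hρm : Measurable ρ) {F : ℝ → ℝ} (hF : Measurable F)
    (a b : ℝ) : ∫ s in a..b, ρ s * F (Z s) = ∫ x in Z a..Z b, F x := by
  have hc := continuous_of_primitive hi hZ
  have hm := monotone_of_primitive hρ0 hZ
  wlog hab : a ≤ b generalizing a b
  · rw [intervalIntegral.integral_symm, this b a (le_of_not_ge hab),
      ← intervalIntegral.integral_symm]
  rw [intervalIntegral.integral_of_le hab, intervalIntegral.integral_of_le (hm hab),
    ← map_restrict_densMeasure hρ0 hi hZ ht hb a b,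
    integral_map hc.aemeasurable hF.aestronglyMeasurable, densMeasure,
    restrict_withDensity measurableSet_Ioc,
    integral_withDensity_eq_integral_toReal_smul hρm.ennreal_ofReal (by simp)]
  simp [ENNReal.toReal_ofReal (hρ0 _)]

end Pushforward

/-! ### Weak derivatives on the half-line. -/

/-- A test function on the open half-line has its support in some `[ε, R]` with `0 < ε < R`. -/
lemma exists_Icc_of_tsupport {ψ : ℝ → ℝ} (hc : HasCompactSupport ψ) (hs : tsupport ψ ⊆ Ioi 0) :
    ∃ ε R : ℝ, 0 < ε ∧ ε < R ∧ tsupport ψ ⊆ Icc ε R := by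
  rcases (tsupport ψ).eq_empty_or_nonempty with h | h
  · exact ⟨1, 2, one_pos, by norm_num, by simp [h]⟩
  · obtain ⟨a, ha⟩ := IsCompact.exists_isLeast hc h
    obtain ⟨b, hb⟩ := IsCompact.exists_isGreatest hc h
    exact ⟨a, b + 1, hs ha.1, by linarith [ha.2 hb.1], fun x hx =>
      ⟨ha.2 hx, by linarith [hb.2 hx]⟩⟩

lemma integral_Ioi_eq_intervalIntegral {F : ℝ → ℝ} {R : ℝ} (hR : 0 ≤ R)
    (h : ∀ x, R < x → F x = 0) : ∫ x in Ioi (0 : ℝ), F x = ∫ x in (0 : ℝ)..R, F x := by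
  rw [intervalIntegral.integral_of_le hR]
  refine (setIntegral_eq_of_subset_of_forall_sdiff_eq_zero measurableSet_Ioi
    (fun x hx => hx.1) fun x hx => ?_)
  apply h
  by_contra! h'
  exact hx.2 ⟨hx.1, h'⟩

/-- The primitive of a locally integrable function has this function as its weak derivative. -/
lemma integral_primitive_mul_deriv {g : ℝ → ℝ} (hg : ∀ R, IntegrableOn g (Icc 0 R))
    {ψ : ℝ → ℝ} (hψ : ContDiff ℝ ∞ ψ) (hc : HasCompactSupport ψ) (hs : tsupport ψ ⊆ Ioi 0) :
    ∫ x in Ioi (0 : ℝ), (∫ y in (0 : ℝ)..x, g y) * deriv ψ x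
      = -∫ x in Ioi (0 : ℝ), g x * ψ x := by
  obtain ⟨ε, R, hε, hR, hsub⟩ := exists_Icc_of_tsupport hc hs
  have h0 : ∀ x, R < x → ψ x = 0 := fun x hx =>
    image_eq_zero_of_notMem_tsupport fun h => absurd (hsub h).2 (not_le.2 hx)
  have h0' : ∀ x, R < x → deriv ψ x = 0 := fun x hx => by
    by_contra h
    exact absurd (hsub ((tsupport_deriv_subset (𝕜 := ℝ)) (subset_tsupport _ h))).2 (not_le.2 hx)
  rw [integral_Ioi_eq_intervalIntegral (R := R + 1) (by linarith)
      fun x hx => by rw [h0' x (by linarith), mul_zero],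
    integral_Ioi_eq_intervalIntegral (R := R + 1) (by linarith)
      fun x hx => by rw [h0 x (by linarith), mul_zero]]
  have hgi : IntervalIntegrable g volume 0 (R + 1) := by
    rw [intervalIntegrable_iff_integrableOn_Icc_of_le (by linarith)]; exact hg _
  have h1 : AbsolutelyContinuousOnInterval (fun x => ∫ y in (0 : ℝ)..x, g y) 0 (R + 1) :=
    hgi.absolutelyContinuousOnInterval_intervalIntegral (by simp)
  have h2 : AbsolutelyContinuousOnInterval ψ 0 (R + 1) :=
    ((hψ.of_le (by simp)).contDiffOn).absolutelyContinuousOnInterval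
  rw [h1.integral_mul_deriv_eq_deriv_mul h2, h0 (R + 1) (by linarith)]
  simp only [mul_zero, intervalIntegral.integral_same, zero_mul, sub_zero, zero_sub]
  congr 1
  refine intervalIntegral.integral_congr_ae ?_
  filter_upwards [hgi.ae_hasDerivAt_integral] with x hx hx'
  rw [(hx (uIoc_subset_uIcc hx') 0 (by simp)).deriv]

/-- A continuous function with zero weak derivative on the half-line is constant. -/
lemma eq_const_of_weakDeriv_zero {H : ℝ → ℝ} (hH : Continuous H)
    (hw : ∀ ψ : ℝ → ℝ, ContDiff ℝ ∞ ψ → HasCompactSupport ψ → tsupport ψ ⊆ Ioi 0 →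
      ∫ x, H x * deriv ψ x = 0) {x : ℝ} (hx : 0 ≤ x) : H x = H 0 := by
  let b : ContDiffBump (2 : ℝ) := ⟨1 / 2, 1, by norm_num, by norm_num⟩
  have hbs : tsupport (b.normed volume) ⊆ Ioi 0 := by
    rw [b.tsupport_normed_eq]
    intro y hy
    rw [Metric.mem_closedBall, Real.dist_eq] at hy
    have := abs_le.1 hy
    simp only [b] at this
    exact mem_Ioi.2 (by linarith)
  set ρ := b.normed volume with hρ
  have hρs : ContDiff ℝ ∞ ρ := b.contDiff_normed
  have hρc : HasCompactSupport ρ := b.hasCompactSupport_normed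
  set C := ∫ x, H x * ρ x with hC
  have key : ∀ χ : ℝ → ℝ, ContDiff ℝ ∞ χ → HasCompactSupport χ → tsupport χ ⊆ Ioi 0 →
      ∫ x, χ x • (H x - C) = 0 := by
    intro χ hχ hχc hχs
    set c := ∫ x, χ x with hc
    -- Subtracting `c * ρ` makes the mean zero, so the primitive of `θ` again has compact support in
    -- the open half-line and is an admissible test function.
    set θ : ℝ → ℝ := fun x => χ x - c * ρ x with hθ
    have hθs : ContDiff ℝ ∞ θ := hχ.sub (contDiff_const.mul hρs)
    obtain ⟨ε, R, hε, hR, hsub⟩ := exists_Icc_of_tsupport hχc hχs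
    obtain ⟨ε', R', hε', hR', hsub'⟩ := exists_Icc_of_tsupport hρc hbs
    have hθ0 : ∀ x, x ∉ Icc (min ε ε') (max R R') → θ x = 0 := fun x hx => by
      have h1 : χ x = 0 := image_eq_zero_of_notMem_tsupport fun h =>
        hx ⟨(min_le_left _ _).trans (hsub h).1, (hsub h).2.trans (le_max_left _ _)⟩
      have h2 : ρ x = 0 := image_eq_zero_of_notMem_tsupport fun h =>
        hx ⟨(min_le_right _ _).trans (hsub' h).1, (hsub' h).2.trans (le_max_right _ _)⟩
      simp [hθ, h1, h2]
    have hχi : Integrable χ := hχ.continuous.integrable_of_hasCompactSupport hχc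
    have hρi : Integrable ρ := hρs.continuous.integrable_of_hasCompactSupport hρc
    have hθi : ∫ x, θ x = 0 := by
      rw [hθ, integral_sub hχi (hρi.const_mul c), integral_const_mul, hρ, b.integral_normed]
      simp [hc]
    set ψ : ℝ → ℝ := fun x => ∫ y in (0 : ℝ)..x, θ y with hψ
    have hψd : ∀ x, HasDerivAt ψ (θ x) x := fun x =>
      intervalIntegral.integral_hasDerivAt_right (hθs.continuous.intervalIntegrable _ _)
        (hθs.continuous.stronglyMeasurableAtFilter _ _) hθs.continuous.continuousAt
    have hψ' : deriv ψ = θ := funext fun x => (hψd x).deriv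
    have hψs : ContDiff ℝ ∞ ψ := by
      rw [contDiff_infty_iff_deriv, hψ']
      exact ⟨fun x => (hψd x).differentiableAt, hθs⟩
    have hε0 : 0 < min ε ε' := lt_min hε hε'
    have hψ0 : ∀ x, x ∉ Icc (min ε ε') (max R R') → ψ x = 0 := by
      intro x hx
      rcases lt_or_ge x (min ε ε') with h | h
      · simp only [hψ]
        rw [intervalIntegral.integral_zero_ae]
        refine Eventually.of_forall fun y hy => hθ0 y fun hy' => ?_
        have := hy.2
        rcases le_total 0 x with h0 | h0
        · rw [max_eq_right h0] at this; linarith [hy'.1]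
        · rw [max_eq_left h0] at this; linarith [hy'.1]
      · have h' : max R R' < x := by
          by_contra! h''
          exact hx ⟨h, h''⟩
        rw [← hθi]
        simp only [hψ]
        rw [intervalIntegral.integral_of_le (by linarith)]
        refine setIntegral_eq_integral_of_forall_compl_eq_zero fun y hy => hθ0 y fun hy' => ?_
        exact hy ⟨by linarith [hy'.1], by linarith [hy'.2]⟩
    have hψt : tsupport ψ ⊆ Icc (min ε ε') (max R R') :=
      closure_minimal (fun x hx => by
        by_contra h
        exact hx (hψ0 x h)) isClosed_Icc
    have h1 := hw ψ hψs (HasCompactSupport.of_support_subset_isCompact isCompact_Icc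
      ((subset_tsupport _).trans hψt)) (hψt.trans fun y hy => lt_of_lt_of_le hε0 hy.1)
    rw [hψ'] at h1
    have i1 : Integrable fun x => H x * χ x :=
      (hH.mul hχ.continuous).integrable_of_hasCompactSupport hχc.mul_left
    have i2 : Integrable fun x => H x * ρ x :=
      (hH.mul hρs.continuous).integrable_of_hasCompactSupport hρc.mul_left
    have h2 : ∫ x, H x * θ x = (∫ x, H x * χ x) - c * C := by
      rw [hC, ← integral_const_mul, ← integral_sub i1 (i2.const_mul c)]
      congr 1; ext x; simp only [hθ]; ring
    have h3 : ∫ x, χ x • (H x - C) = (∫ x, H x * χ x) - c * C := by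
      rw [mul_comm c C, hc, ← integral_const_mul, ← integral_sub i1 (hχi.const_mul C)]
      congr 1; ext x; simp only [smul_eq_mul]; ring
    rw [h3, ← h2, h1]
  have hae := isOpen_Ioi.ae_eq_zero_of_integral_contDiff_smul_eq_zero (μ := volume)
    (f := fun x => H x - C) (U := Ioi (0 : ℝ))
    ((hH.sub continuous_const).locallyIntegrable.locallyIntegrableOn _) key
  have heq : EqOn (fun x => H x - C) (fun _ => 0) (Ioi 0) := by
    refine Measure.eqOn_open_of_ae_eq (μ := volume) ?_ isOpen_Ioi (by fun_prop) (by fun_prop)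
    rw [EventuallyEq, ae_restrict_iff' measurableSet_Ioi]
    exact hae
  have heq' := heq.of_subset_closure (t := Ici 0) (by fun_prop) (by fun_prop) Ioi_subset_Ici_self
    (by rw [closure_Ioi])
  have h1 := heq' (mem_Ici.2 hx)
  have h2 := heq' (mem_Ici.2 (le_refl (0 : ℝ)))
  simp only at h1 h2
  linarith

/-- A continuous function on the half-line is the primitive of its weak derivative. -/
lemma eq_primitive_of_weakDeriv {v g : ℝ → ℝ} (hv : ContinuousOn v (Ici 0))
    (hg : ∀ R, IntegrableOn g (Icc 0 R)) (hw : IsWeakDerivHalfLine v g) {x : ℝ} (hx : 0 ≤ x) :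
    v x = v 0 + ∫ y in (0 : ℝ)..x, g y := by
  have hgc : ContinuousOn (fun x => ∫ y in (0 : ℝ)..x, g y) (Ici 0) := by
    intro y hy
    have h1 : IntervalIntegrable g volume 0 (y + 1) := by
      rw [intervalIntegrable_iff_integrableOn_Icc_of_le (by linarith [mem_Ici.1 hy])]; exact hg _
    have h2 := (intervalIntegral.continuousOn_primitive_interval' h1 left_mem_uIcc) y
      (by
        rw [uIcc_of_le (by linarith [mem_Ici.1 hy])]
        exact ⟨hy, by linarith⟩)
    rw [uIcc_of_le (by linarith [mem_Ici.1 hy])] at h2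
    refine h2.mono_of_mem_nhdsWithin ?_
    rw [mem_nhdsWithin]
    exact ⟨Iio (y + 1), isOpen_Iio, by simp, fun z hz => ⟨hz.2, hz.1.le⟩⟩
  -- Freezing the argument at 0 on the negative axis gives a function continuous on the whole line
  -- without changing integrals against test functions.
  set H : ℝ → ℝ := fun x => v (max x 0) - ∫ y in (0 : ℝ)..(max x 0), g y with hH
  have hHc : Continuous H := by
    refine ((hv.sub hgc).comp_continuous (f := fun x => max x 0) (by fun_prop) fun x => ?_)
    exact mem_Ici.2 (le_max_right _ _)
  have := eq_const_of_weakDeriv_zero hHc (fun ψ hψ hc hs => ?_) hx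
  · simp only [hH, max_eq_left hx, max_self, intervalIntegral.integral_same] at this
    linarith
  · have h0 : ∀ x, x ∉ Ioi (0 : ℝ) → deriv ψ x = 0 := fun x hx => by
      by_contra h
      exact hx (hs ((tsupport_deriv_subset (𝕜 := ℝ)) (subset_tsupport _ h)))
    have hdc : Continuous (deriv ψ) := hψ.continuous_deriv (by simp)
    have hdcs : HasCompactSupport (deriv ψ) := hc.deriv
    have hmax : Continuous fun x : ℝ => max x 0 := by fun_prop
    have c1 : Continuous fun x => v (max x 0) :=
      hv.comp_continuous hmax fun x => mem_Ici.2 (le_max_right _ _)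
    have c2 : Continuous fun x => ∫ y in (0 : ℝ)..(max x 0), g y :=
      hgc.comp_continuous hmax fun x => mem_Ici.2 (le_max_right _ _)
    have e1 : ∫ x in Ioi (0 : ℝ), v x * deriv ψ x = ∫ x, v (max x 0) * deriv ψ x :=
      (setIntegral_congr_fun measurableSet_Ioi fun x hx => by
        simp only [max_eq_left (mem_Ioi.1 hx).le]).trans
      (setIntegral_eq_integral_of_forall_compl_eq_zero fun x hx => by rw [h0 x hx, mul_zero])
    have e2 : ∫ x in Ioi (0 : ℝ), (∫ y in (0 : ℝ)..x, g y) * deriv ψ x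
        = ∫ x, (∫ y in (0 : ℝ)..(max x 0), g y) * deriv ψ x :=
      (setIntegral_congr_fun measurableSet_Ioi fun x hx => by
        simp only [max_eq_left (mem_Ioi.1 hx).le]).trans
      (setIntegral_eq_integral_of_forall_compl_eq_zero fun x hx => by rw [h0 x hx, mul_zero])
    have e3 := hw ψ hψ hc hs
    have e4 := integral_primitive_mul_deriv hg hψ hc hs
    rw [e1] at e3
    rw [e2] at e4
    simp only [hH, sub_mul]
    have i1 : Integrable fun x => v (max x 0) * deriv ψ x :=
      (c1.mul hdc).integrable_of_hasCompactSupport hdcs.mul_left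
    have i2 : Integrable fun x => (∫ y in (0 : ℝ)..(max x 0), g y) * deriv ψ x :=
      (c2.mul hdc).integrable_of_hasCompactSupport hdcs.mul_left
    rw [integral_sub i1 i2, e3, e4, sub_self]

/-! ### The Lagrangian equation, solved by contraction. -/

/-- The time integral of `h (U ξ ·)` along the characteristic `ξ`. -/
noncomputable def accum (h : ℝ → ℝ) (U : ℝ → ℝ → ℝ) (ξ t : ℝ) : ℝ := ∫ s in (0 : ℝ)..t, h (U ξ s)

/-- The signed root of the stretching factor of the characteristics. -/
noncomputable def stretch (lam : ℝ) (h p₀ G : ℝ → ℝ) (U : ℝ → ℝ → ℝ) (ξ t : ℝ) : ℝ :=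
  p₀ ξ + lam * G ξ * accum h U ξ t

/-- The value of the solution in Lagrangian coordinates, as a functional of its values. -/
noncomputable def lagOp (lam : ℝ) (h p₀ G : ℝ → ℝ) (U : ℝ → ℝ → ℝ) (ξ t : ℝ) : ℝ :=
  ∫ η in (0 : ℝ)..ξ, G η * signedPow (1 / lam) (stretch lam h p₀ G U η t)

/-- Admissible Lagrangian data together with bounds for the nonlinearity. -/
structure LagrangianData (lam L M : ℝ) (h p₀ G : ℝ → ℝ) : Prop where
  lam_pos : 0 < lam
  lam_le : lam ≤ 1 / 2
  L_nonneg : 0 ≤ L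
  lip : ∀ a b, |h a - h b| ≤ L * |a - b|
  bdd : ∀ a, |h a| ≤ M
  meas_p : Measurable p₀
  meas_G : Measurable G
  p_nonneg : ∀ ξ, 0 ≤ p₀ ξ
  p_le : ∀ ξ, p₀ ξ ≤ 1
  G_le : ∀ ξ, |G ξ| ≤ 1

namespace LagrangianData

variable {lam L M : ℝ} {h p₀ G : ℝ → ℝ} {U V : ℝ → ℝ → ℝ}

section
variable (D : LagrangianData lam L M h p₀ G)
include D

lemma two_le : 2 ≤ 1 / lam := by
  rw [le_div_iff₀ D.lam_pos]; linarith [D.lam_le]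

lemma M_nonneg : 0 ≤ M := (abs_nonneg _).trans (D.bdd 0)

lemma continuous_h : Continuous h := by
  refine (LipschitzWith.of_dist_le_mul (K := L.toNNReal) fun x y => ?_).continuous
  rw [Real.coe_toNNReal L D.L_nonneg]
  exact D.lip x y

lemma continuous_accum (hU : Continuous (Function.uncurry U)) :
    Continuous fun z : ℝ × ℝ => accum h U z.1 z.2 := by
  refine intervalIntegral.continuous_parametric_intervalIntegral_of_continuous
    (f := fun (z : ℝ × ℝ) s => h (U z.1 s)) ?_ continuous_snd
  exact D.continuous_h.comp (hU.comp ((continuous_fst.comp continuous_fst).prodMk continuous_snd))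

lemma hasDerivAt_accum (hU : Continuous (Function.uncurry U)) (ξ t : ℝ) :
    HasDerivAt (accum h U ξ) (h (U ξ t)) t := by
  have hc : Continuous fun s => h (U ξ s) :=
    D.continuous_h.comp (hU.comp (continuous_const.prodMk continuous_id))
  exact intervalIntegral.integral_hasDerivAt_right (hc.intervalIntegrable _ _)
    (hc.stronglyMeasurableAtFilter _ _) hc.continuousAt

omit D in
lemma abs_accum_le (D : LagrangianData lam L M h p₀ G) (ξ t : ℝ) : |accum h U ξ t| ≤ M * |t| := by
  have := intervalIntegral.norm_integral_le_of_norm_le_const (f := fun s => h (U ξ s)) (a := 0)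
    (b := t) (C := M) (fun s _ => D.bdd _)
  simpa [accum] using this

lemma abs_stretch_le {ξ t T : ℝ} (ht : |t| ≤ T) : 
    |stretch lam h p₀ G U ξ t| ≤ 1 + lam * M * T := by
  have h1 : |lam * G ξ * accum h U ξ t| ≤ lam * M * T := by
    rw [abs_mul, abs_mul, abs_of_pos D.lam_pos]
    calc lam * |G ξ| * |accum h U ξ t| ≤ lam * 1 * (M * T) := by
          have := D.G_le ξ
          have h2 := D.abs_accum_le (U := U) ξ t
          have h3 : M * |t| ≤ M * T := mul_le_mul_of_nonneg_left ht D.M_nonneg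
          have := D.lam_pos
          gcongr
          exact h2.trans h3
      _ = lam * M * T := by ring
  calc |stretch lam h p₀ G U ξ t| ≤ |p₀ ξ| + |lam * G ξ * accum h U ξ t| := abs_add_le _ _
    _ ≤ 1 + lam * M * T := add_le_add (by rw [abs_of_nonneg (D.p_nonneg ξ)]; exact D.p_le ξ) h1

lemma bound_pos {T : ℝ} (hT : 0 ≤ T) : 1 ≤ 1 + lam * M * T := by
  have := D.lam_pos; have := D.M_nonneg
  have : 0 ≤ lam * M * T := by positivity
  linarith

lemma measurable_stretch (hU : Continuous (Function.uncurry U)) :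
    Measurable fun z : ℝ × ℝ => stretch lam h p₀ G U z.1 z.2 :=
  (D.meas_p.comp measurable_fst).add (((D.meas_G.comp measurable_fst).const_mul lam).mul
    (D.continuous_accum hU).measurable)

lemma hasDerivAt_stretch (hU : Continuous (Function.uncurry U)) (ξ t : ℝ) :
    HasDerivAt (stretch lam h p₀ G U ξ) (lam * G ξ * h (U ξ t)) t :=
  ((D.hasDerivAt_accum hU ξ t).const_mul (lam * G ξ)).const_add (p₀ ξ)

lemma continuous_stretch (hU : Continuous (Function.uncurry U)) (ξ : ℝ) :
    Continuous (stretch lam h p₀ G U ξ) :=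
  continuous_iff_continuousAt.2 fun t => (D.hasDerivAt_stretch hU ξ t).continuousAt

lemma measurable_slope (hU : Continuous (Function.uncurry U)) : Measurable fun z : ℝ × ℝ =>
    G z.1 * signedPow (1 / lam) (stretch lam h p₀ G U z.1 z.2) :=
  (D.meas_G.comp measurable_fst).mul
    ((continuous_signedPow D.two_le).measurable.comp (D.measurable_stretch hU))

lemma abs_slope_le {ξ t T : ℝ} (ht : |t| ≤ T) :
    |G ξ * signedPow (1 / lam) (stretch lam h p₀ G U ξ t)|
      ≤ (1 + lam * M * T) ^ (1 / lam - 1) := by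
  rw [abs_mul, abs_signedPow D.two_le]
  have h1 := D.abs_stretch_le (U := U) (ξ := ξ) ht
  have h2 := D.two_le
  calc |G ξ| * |stretch lam h p₀ G U ξ t| ^ (1 / lam - 1)
      ≤ 1 * (1 + lam * M * T) ^ (1 / lam - 1) := by
        gcongr
        · exact D.G_le ξ
        · linarith
    _ = _ := one_mul _

lemma measurable_slope_slice (hU : Continuous (Function.uncurry U)) (t : ℝ) :
    Measurable fun η => G η * signedPow (1 / lam) (stretch lam h p₀ G U η t) :=
  (D.measurable_slope hU).comp (measurable_id.prodMk measurable_const)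

lemma intervalIntegrable_slope (hU : Continuous (Function.uncurry U)) (t a b : ℝ) :
    IntervalIntegrable (fun η => G η * signedPow (1 / lam) (stretch lam h p₀ G U η t))
      volume a b :=
  intervalIntegrable_of_bounded (D.measurable_slope_slice hU t)
    (fun _ => D.abs_slope_le (le_refl |t|)) a b

lemma continuous_lagOp (hU : Continuous (Function.uncurry U)) :
    Continuous fun z : ℝ × ℝ => lagOp lam h p₀ G U z.1 z.2 :=
  continuous_parametric_primitive
    (F := fun t η => G η * signedPow (1 / lam) (stretch lam h p₀ G U η t))
    (D.measurable_slope_slice hU)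
    (fun η => continuous_const.mul ((continuous_signedPow D.two_le).comp
      (D.continuous_stretch hU η))) fun _ _ _ ht => D.abs_slope_le ht

end

/-- The growth rate of the weight in which `lagOp` is a contraction. -/
noncomputable def rate (lam L M t : ℝ) : ℝ :=
  (1 + lam * M * |t|) ^ (1 / lam - 1)
    + 2 * ((1 / lam - 1) * (1 + lam * M * |t|) ^ (1 / lam - 2) * lam * L * |t|)

variable (D : LagrangianData lam L M h p₀ G)
include D

lemma one_le_rate (t : ℝ) : 1 ≤ rate lam L M t := by
  have h1 := D.bound_pos (abs_nonneg t)
  have h2 := D.two_le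
  have h3 : 1 ≤ (1 + lam * M * |t|) ^ (1 / lam - 1) := Real.one_le_rpow h1 (by linarith)
  have h4 : 0 ≤ 2 * ((1 / lam - 1) * (1 + lam * M * |t|) ^ (1 / lam - 2) * lam * L * |t|) := by
    have := D.lam_pos; have := D.L_nonneg
    have : 0 ≤ 1 / lam - 1 := by linarith
    positivity
  unfold rate; linarith

/-- The history up to time `t` involves only times with |s| ≤ |t|; by monotonicity the weight at `t`
dominates the weights at those times. -/
lemma rate_mono {s t : ℝ} (hst : |s| ≤ |t|) : rate lam L M s ≤ rate lam L M t := by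
  have h1 := D.bound_pos (abs_nonneg s)
  have h2 := D.two_le
  have := D.lam_pos; have := D.L_nonneg; have := D.M_nonneg
  have h3 : 0 ≤ 1 / lam - 1 := by linarith
  have h4 : 0 ≤ 1 / lam - 2 := by linarith
  unfold rate
  gcongr

lemma continuous_rate : Continuous (rate lam L M) := by
  have h2 := D.two_le
  have h3 : ∀ e : ℝ, 0 ≤ e → Continuous fun t : ℝ => (1 + lam * M * |t|) ^ e := fun e he =>
    (by fun_prop : Continuous fun t : ℝ => 1 + lam * M * |t|).rpow_const fun _ => Or.inr he
  have h4 := h3 (1 / lam - 1) (by linarith)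
  have h5 := h3 (1 / lam - 2) (by linarith)
  unfold rate
  fun_prop

omit D in
-- Integrating an exponential of rate κ gains the factor 1/κ, the source of the contraction.
-- Negative `ξ` reduces to positive by reflection.
lemma abs_integral_le_of_le_exp {F : ℝ → ℝ} {A κ : ℝ} (hκ : 0 < κ)
    (hF : ∀ η, |F η| ≤ A * Real.exp (|η| * κ)) (ξ : ℝ) :
    |∫ η in (0 : ℝ)..ξ, F η| ≤ A / κ * Real.exp (|ξ| * κ) := by
  have hA : 0 ≤ A := by
    have := (abs_nonneg _).trans (hF 0)
    simpa using this
  have key : ∀ F : ℝ → ℝ, (∀ η, |F η| ≤ A * Real.exp (|η| * κ)) → ∀ ξ, 0 ≤ ξ →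
      |∫ η in (0 : ℝ)..ξ, F η| ≤ A / κ * Real.exp (|ξ| * κ) := by
    intro F hF ξ hξ
    have hc : Continuous fun η : ℝ => A * Real.exp (η * κ) := by fun_prop
    have h1 : ∫ η in (0 : ℝ)..ξ, A * Real.exp (η * κ)
        = A / κ * Real.exp (ξ * κ) - A / κ * Real.exp (0 * κ) := by
      refine intervalIntegral.integral_eq_sub_of_hasDerivAt
        (f := fun η => A / κ * Real.exp (η * κ)) (fun η _ => ?_) (hc.intervalIntegrable _ _)
      convert! (((hasDerivAt_id η).mul_const κ).exp).const_mul (A / κ) using 1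
      simp only [id_eq]; field_simp
    have h2 := intervalIntegral.norm_integral_le_of_norm_le (f := F)
      (g := fun η => A * Real.exp (η * κ)) (μ := volume) hξ
      (Eventually.of_forall fun η hη => by
        have := hF η
        rwa [abs_of_pos hη.1] at this) (hc.intervalIntegrable _ _)
    rw [h1, Real.norm_eq_abs] at h2
    rw [abs_of_nonneg hξ]
    have : 0 ≤ A / κ * Real.exp (0 * κ) := by positivity
    linarith
  rcases le_total 0 ξ with hξ | hξ
  · exact key F hF ξ hξ
  · have := key (fun η => F (-η)) (fun η => by simpa using hF (-η)) (-ξ) (by linarith)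
    rw [intervalIntegral.integral_comp_neg] at this
    rw [intervalIntegral.integral_symm, abs_neg]
    simpa using this

/-- The integrands differ by at most `c * d` times the weight, where `c` is the Lipschitz constant
produced by the signed power and the history. Since `rate` is at least `2 * c`, the gain from
integration leaves the factor 1/2. -/
lemma abs_lagOp_sub_le (hU : Continuous (Function.uncurry U)) (hV : Continuous (Function.uncurry V))
    {d : ℝ} (hd : 0 ≤ d)
    (hUV : ∀ ξ t, |U ξ t - V ξ t| ≤ d * Real.exp (|ξ| * rate lam L M t)) (ξ t : ℝ) :
    |lagOp lam h p₀ G U ξ t - lagOp lam h p₀ G V ξ t|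
      ≤ 1 / 2 * d * Real.exp (|ξ| * rate lam L M t) := by
  have hr := D.one_le_rate t
  have h2 := D.two_le
  have hB := D.bound_pos (abs_nonneg t)
  have hlam := D.lam_pos
  have hL := D.L_nonneg
  set c := (1 / lam - 1) * (1 + lam * M * |t|) ^ (1 / lam - 2) * lam * L * |t| with hc
  have hc0 : 0 ≤ c := by
    have : 0 ≤ 1 / lam - 1 := by linarith
    positivity
  have hJ : ∀ η, |accum h U η t - accum h V η t|
      ≤ L * d * Real.exp (|η| * rate lam L M t) * |t| := by
    intro η
    have cU : Continuous fun s => h (U η s) :=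
      D.continuous_h.comp (hU.comp (continuous_const.prodMk continuous_id))
    have cV : Continuous fun s => h (V η s) :=
      D.continuous_h.comp (hV.comp (continuous_const.prodMk continuous_id))
    unfold accum
    rw [← intervalIntegral.integral_sub (cU.intervalIntegrable _ _) (cV.intervalIntegrable _ _)]
    have := intervalIntegral.norm_integral_le_of_norm_le_const
      (f := fun s => h (U η s) - h (V η s)) (a := 0) (b := t)
      (C := L * d * Real.exp (|η| * rate lam L M t)) (fun s hs => by
        have hs' : |s| ≤ |t| := by
          rcases le_total 0 t with h0 | h0
          · rw [uIoc_of_le h0] at hs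
            rw [abs_of_pos hs.1, abs_of_nonneg h0]; exact hs.2
          · rw [uIoc_of_ge h0] at hs
            rw [abs_of_nonpos hs.2, abs_of_nonpos h0]; linarith [hs.1]
        calc |h (U η s) - h (V η s)| ≤ L * |U η s - V η s| := D.lip _ _
          _ ≤ L * (d * Real.exp (|η| * rate lam L M s)) := by gcongr; exact hUV _ _
          _ ≤ L * (d * Real.exp (|η| * rate lam L M t)) := by
              gcongr; exact D.rate_mono hs'
          _ = _ := by ring)
    simpa using this
  unfold lagOp
  rw [← intervalIntegral.integral_sub (D.intervalIntegrable_slope hU t 0 ξ)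
    (D.intervalIntegrable_slope hV t 0 ξ)]
  refine (abs_integral_le_of_le_exp (A := c * d) (by linarith : 0 < rate lam L M t)
    (fun η => ?_) ξ).trans ?_
  · rw [← mul_sub, abs_mul]
    have e1 := abs_signedPow_sub_le D.two_le (D.abs_stretch_le (U := U) (ξ := η) le_rfl)
      (D.abs_stretch_le (U := V) (ξ := η) (le_refl |t|))
    have e2 : |stretch lam h p₀ G U η t - stretch lam h p₀ G V η t|
        ≤ lam * (L * d * Real.exp (|η| * rate lam L M t) * |t|) := by
      have : stretch lam h p₀ G U η t - stretch lam h p₀ G V η t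
          = lam * G η * (accum h U η t - accum h V η t) := by unfold stretch; ring
      rw [this, abs_mul, abs_mul, abs_of_pos hlam]
      have := D.G_le η
      have hj := hJ η
      calc lam * |G η| * |accum h U η t - accum h V η t|
          ≤ lam * 1 * (L * d * Real.exp (|η| * rate lam L M t) * |t|) := by gcongr
        _ = _ := by ring
    calc |G η| * _ ≤ 1 * ((1 / lam - 1) * (1 + lam * M * |t|) ^ (1 / lam - 2) *
          (lam * (L * d * Real.exp (|η| * rate lam L M t) * |t|))) := by
          have : 0 ≤ 1 / lam - 1 := by linarith
          refine mul_le_mul (D.G_le η) (e1.trans ?_) (abs_nonneg _) zero_le_one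
          gcongr
      _ = c * d * Real.exp (|η| * rate lam L M t) := by rw [hc]; ring
  · have : c * d / rate lam L M t ≤ 1 / 2 * d := by
      rw [div_le_iff₀ (by linarith)]
      have : 2 * c ≤ rate lam L M t := by
        have : 0 ≤ (1 + lam * M * |t|) ^ (1 / lam - 1) := by positivity
        unfold rate; linarith
      nlinarith
    gcongr

/-- The Lagrangian equation has a global solution. -/
theorem exists_solution :
    ∃ U : ℝ → ℝ → ℝ, Continuous (Function.uncurry U) ∧ ∀ ξ t, U ξ t = lagOp lam h p₀ G U ξ t := by
  set wt : ℝ × ℝ → ℝ := fun z => Real.exp (|z.1| * rate lam L M z.2) with hwt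
  have hwc : Continuous wt := by
    have := D.continuous_rate
    fun_prop
  have hwp : ∀ z, 0 < wt z := fun z => Real.exp_pos _
  -- The unknown is `U` divided by the weight; `T` is `lagOp` conjugated by the weight, so that the
  -- usual sup norm applies.
  let W : BoundedContinuousFunction (ℝ × ℝ) ℝ → ℝ → ℝ → ℝ := fun b ξ t => wt (ξ, t) * b (ξ, t)
  have hWc : ∀ b, Continuous (Function.uncurry (W b)) := fun b => hwc.mul b.continuous
  let T : BoundedContinuousFunction (ℝ × ℝ) ℝ → BoundedContinuousFunction (ℝ × ℝ) ℝ := fun b =>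
    BoundedContinuousFunction.ofNormedAddCommGroup
      (fun z => lagOp lam h p₀ G (W b) z.1 z.2 / wt z)
      ((D.continuous_lagOp (hWc b)).div hwc fun z => (hwp z).ne') 1 (fun z => by
        rw [norm_div, Real.norm_eq_abs, Real.norm_eq_abs, abs_of_pos (hwp z),
          div_le_one (hwp z)]
        have h1 := intervalIntegral.norm_integral_le_of_norm_le_const
          (f := fun η => G η * signedPow (1 / lam) (stretch lam h p₀ G (W b) η z.2)) (a := 0)
          (b := z.1) (C := (1 + lam * M * |z.2|) ^ (1 / lam - 1))
          (fun η _ => D.abs_slope_le le_rfl)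
        rw [sub_zero] at h1
        -- The first summand of `rate` is there for this bound: |`lagOp`| is at most |ξ| times the
        -- rate, hence at most its exponential, so `T` takes values bounded by 1.
        have h2 : (1 + lam * M * |z.2|) ^ (1 / lam - 1) ≤ rate lam L M z.2 := by
          have := D.two_le; have := D.lam_pos; have := D.L_nonneg
          have := D.bound_pos (abs_nonneg z.2)
          have : 0 ≤ 1 / lam - 1 := by linarith
          have : 0 ≤ 2 * ((1 / lam - 1) * (1 + lam * M * |z.2|) ^ (1 / lam - 2)
            * lam * L * |z.2|) := by positivity
          unfold rate; linarith
        calc |lagOp lam h p₀ G (W b) z.1 z.2| ≤ _ := h1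
          _ ≤ rate lam L M z.2 * |z.1| := by gcongr
          _ ≤ wt z := by
            rw [mul_comm]
            exact le_trans (by linarith) (Real.add_one_le_exp _))
  have hT : ContractingWith (1 / 2) T := by
    refine ⟨by norm_num, LipschitzWith.of_dist_le_mul fun b b' => ?_⟩
    rw [BoundedContinuousFunction.dist_le (by positivity)]
    intro z
    have h1 := D.abs_lagOp_sub_le (hWc b) (hWc b') (d := dist b b') dist_nonneg
      (fun ξ t => by
        have : W b ξ t - W b' ξ t = (b (ξ, t) - b' (ξ, t)) * wt (ξ, t) := by
          simp only [W]; ring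
        rw [this, abs_mul, abs_of_pos (hwp _)]
        exact mul_le_mul_of_nonneg_right (b.dist_coe_le_dist (g := b') (ξ, t)) (hwp _).le) z.1 z.2
    change |lagOp lam h p₀ G (W b) z.1 z.2 / wt z - lagOp lam h p₀ G (W b') z.1 z.2 / wt z| ≤ _
    rw [← sub_div, abs_div, abs_of_pos (hwp z), div_le_iff₀ (hwp z)]
    simpa [hwt] using h1
  set b := hT.fixedPoint with hb
  have hfix : T b = b := hT.fixedPoint_isFixedPt
  refine ⟨W b, hWc b, fun ξ t => ?_⟩
  have : T b (ξ, t) = b (ξ, t) := by rw [hfix]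
  change lagOp lam h p₀ G (W b) ξ t / wt (ξ, t) = b (ξ, t) at this
  rw [div_eq_iff (hwp _).ne'] at this
  rw [this]
  simp only [W]; ring

end LagrangianData

/-! ### Motion and regularity of characteristics. -/

/-- The density of the characteristics in Lagrangian coordinates. -/
noncomputable def charDens (lam : ℝ) (h p₀ G : ℝ → ℝ) (U : ℝ → ℝ → ℝ) (t ξ : ℝ) : ℝ :=
  |stretch lam h p₀ G U ξ t| ^ (1 / lam)

/-- The position at time `t` of the characteristic with label `ξ`. -/
noncomputable def charPos (lam v₀ : ℝ) (h p₀ G : ℝ → ℝ) (U : ℝ → ℝ → ℝ) (t ξ : ℝ) : ℝ :=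
  v₀ * t + ∫ η in (0 : ℝ)..ξ, charDens lam h p₀ G U t η

/-- A solution of the Lagrangian equation; `F` is the characteristic speed, with derivative `h`. -/
structure LagrangianSolution (lam L M : ℝ) (F h p₀ G : ℝ → ℝ) (U : ℝ → ℝ → ℝ) : Prop
    extends LagrangianData lam L M h p₀ G where
  contDiff_F : ContDiff ℝ 1 F
  deriv_F : deriv F = h
  cont : Continuous (Function.uncurry U)
  eq : ∀ ξ t, U ξ t = lagOp lam h p₀ G U ξ t

namespace LagrangianSolution

variable {lam L M : ℝ} {F h p₀ G : ℝ → ℝ} {U : ℝ → ℝ → ℝ}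
  (S : LagrangianSolution lam L M F h p₀ G U)
include S

lemma one_sub_pos : 0 < 1 - lam := by linarith [S.lam_le]

lemma apply_zero (t : ℝ) : U 0 t = 0 := by rw [S.eq]; simp [lagOp]

lemma sub_eq_integral (t a b : ℝ) : U b t - U a t
    = ∫ η in a..b, G η * signedPow (1 / lam) (stretch lam h p₀ G U η t) := by
  rw [S.eq b, S.eq a, lagOp, lagOp, intervalIntegral.integral_interval_sub_left] <;>
  exact S.toLagrangianData.intervalIntegrable_slope S.cont _ _ _

omit S in
lemma charDens_nonneg (t ξ : ℝ) : 0 ≤ charDens lam h p₀ G U t ξ :=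
  Real.rpow_nonneg (abs_nonneg _) _

lemma charDens_le {t T : ℝ} (ht : |t| ≤ T) (ξ : ℝ) :
    charDens lam h p₀ G U t ξ ≤ (1 + lam * M * T) ^ (1 / lam) :=
  Real.rpow_le_rpow (abs_nonneg _) (S.abs_stretch_le ht) (by linarith [S.two_le])

lemma measurable_charDens : Measurable fun z : ℝ × ℝ => charDens lam h p₀ G U z.2 z.1 :=
  (continuous_abs_rpow (by linarith [S.two_le])).measurable.comp (S.measurable_stretch S.cont)

lemma measurable_charDens_slice (t : ℝ) : Measurable (charDens lam h p₀ G U t) :=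
  S.measurable_charDens.comp (measurable_id.prodMk measurable_const)

lemma abs_charDens_le {t T : ℝ} (ht : |t| ≤ T) (ξ : ℝ) :
    |charDens lam h p₀ G U t ξ| ≤ (1 + lam * M * T) ^ (1 / lam) := by
  rw [abs_of_nonneg (charDens_nonneg _ _)]; exact S.charDens_le ht ξ

lemma intervalIntegrable_charDens (t a b : ℝ) :
    IntervalIntegrable (charDens lam h p₀ G U t) volume a b :=
  intervalIntegrable_of_bounded (S.measurable_charDens_slice t)
    (fun ξ => S.abs_charDens_le (le_refl |t|) ξ) a b

lemma charPos_sub (v₀ t a b : ℝ) : charPos lam v₀ h p₀ G U t b - charPos lam v₀ h p₀ G U t a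
    = ∫ η in a..b, charDens lam h p₀ G U t η := by
  unfold charPos
  rw [add_sub_add_left_eq_sub, intervalIntegral.integral_interval_sub_left] <;>
  exact S.intervalIntegrable_charDens _ _ _

lemma monotone_charPos (v₀ t : ℝ) : Monotone (charPos lam v₀ h p₀ G U t) :=
  monotone_of_primitive (charDens_nonneg t) (S.charPos_sub v₀ t)

lemma continuous_charPos (v₀ : ℝ) :
    Continuous fun z : ℝ × ℝ => charPos lam v₀ h p₀ G U z.2 z.1 := by
  refine (continuous_const.mul continuous_snd).add (continuous_parametric_primitive
    (F := charDens lam h p₀ G U) S.measurable_charDens_slice (fun η => ?_)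
    fun T t η ht => S.abs_charDens_le ht η)
  exact (continuous_abs_rpow (by linarith [S.two_le])).comp (S.continuous_stretch S.cont η)

/-- Characteristics move with speed `F (U ξ t)`. -/
lemma hasDerivAt_charPos (ξ t : ℝ) :
    HasDerivAt (fun t => charPos lam (F 0) h p₀ G U t ξ) (F (U ξ t)) t := by
  have hr := S.two_le
  have hlam := S.lam_pos
  -- The time derivative of |p|^r is r p |p|^(r-2) · λ G h(U), and r λ = 1. The result equals h(U)
  -- U_ξ, the label derivative of `F (U ξ t)`; its integral from label 0, where U = 0, is F(U) -
  -- F(0).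
  set q' : ℝ → ℝ → ℝ := fun t η => h (U η t) *
    (G η * signedPow (1 / lam) (stretch lam h p₀ G U η t)) with hq'
  have hq'm : ∀ t, Measurable (q' t) := fun t =>
    (S.continuous_h.comp (S.cont.comp (continuous_id.prodMk continuous_const))).measurable.mul
      (S.measurable_slope_slice S.cont t)
  have hd : ∀ η t, HasDerivAt (fun t => charDens lam h p₀ G U t η) (q' t η) t := by
    intro η t
    have h1 := (hasDerivAt_abs_rpow' hr (stretch lam h p₀ G U η t)).comp t
      (S.hasDerivAt_stretch S.cont η t)
    convert! h1 using 1
    simp only [hq']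
    field_simp
  have h1 := (intervalIntegral.hasDerivAt_integral_of_dominated_loc_of_deriv_le
    (μ := volume) (a := 0) (b := ξ) (F := charDens lam h p₀ G U) (F' := q') (x₀ := t)
    (s := Metric.ball t 1) (bound := fun _ => M * (1 + lam * M * (|t| + 1)) ^ (1 / lam - 1))
    (Metric.ball_mem_nhds t one_pos)
    (Eventually.of_forall fun s => (S.measurable_charDens_slice s).aestronglyMeasurable)
    (S.intervalIntegrable_charDens _ _ _) (hq'm t).aestronglyMeasurable
    (Eventually.of_forall fun η _ s hs => by
      rw [Metric.mem_ball, Real.dist_eq] at hs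
      have hs' : |s| ≤ |t| + 1 := by linarith [abs_sub_abs_le_abs_sub s t]
      rw [Real.norm_eq_abs, abs_mul]
      exact mul_le_mul (S.bdd _) (S.abs_slope_le hs') (abs_nonneg _) S.M_nonneg)
    (by simp) (Eventually.of_forall fun η _ s _ => hd η s)).2
  have h2 : ∫ η in (0 : ℝ)..ξ, q' t η = F (U ξ t) - F 0 := by
    have := integral_deriv_comp_primitive S.contDiff_F (V := fun ξ => U ξ t)
      (S.measurable_slope_slice S.cont t) (fun ξ => S.abs_slope_le (le_refl |t|))
      (fun a b => S.sub_eq_integral t a b) 0 ξ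
    simp only [S.apply_zero, S.deriv_F] at this
    exact this
  rw [h2] at h1
  have h3 := ((hasDerivAt_id t).const_mul (F 0)).add h1
  convert! h3 using 1
  ring

lemma abs_sub_time_le {ξ s t T : ℝ} (hs : |s| ≤ T) (ht : |t| ≤ T) :
    |U ξ t - U ξ s| ≤ (1 / lam - 1) * (1 + lam * M * T) ^ (1 / lam - 2) * (lam * M)
      * |ξ| * |t - s| := by
  have hr := S.two_le
  have hlam := S.lam_pos
  have hM := S.M_nonneg
  have hB := S.bound_pos ((abs_nonneg s).trans hs)
  have hr1 : 0 ≤ 1 / lam - 1 := by linarith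
  have hst : ∀ η, |stretch lam h p₀ G U η t - stretch lam h p₀ G U η s| ≤ lam * M * |t - s| := by
    intro η
    refine abs_sub_le_of_hasDerivAt (B := T) (S.hasDerivAt_stretch S.cont η) (fun x _ => ?_) ht hs
    rw [abs_mul, abs_mul, abs_of_pos hlam]
    calc lam * |G η| * |h (U η x)| ≤ lam * 1 * M := by
          have := S.G_le η; have := S.bdd (U η x); gcongr
      _ = lam * M := by ring
  rw [S.eq ξ t, S.eq ξ s, lagOp, lagOp, ← intervalIntegral.integral_sub
    (S.intervalIntegrable_slope S.cont _ _ _) (S.intervalIntegrable_slope S.cont _ _ _)]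
  have := intervalIntegral.norm_integral_le_of_norm_le_const (a := 0) (b := ξ)
    (f := fun η => G η * signedPow (1 / lam) (stretch lam h p₀ G U η t)
      - G η * signedPow (1 / lam) (stretch lam h p₀ G U η s))
    (C := (1 / lam - 1) * (1 + lam * M * T) ^ (1 / lam - 2) * (lam * M * |t - s|))
    (fun η _ => by
      rw [← mul_sub, norm_mul, Real.norm_eq_abs, Real.norm_eq_abs]
      have e1 := abs_signedPow_sub_le hr (S.abs_stretch_le (U := U) (ξ := η) ht)
        (S.abs_stretch_le (U := U) (ξ := η) hs)
      calc |G η| * _ ≤ 1 * ((1 / lam - 1) * (1 + lam * M * T) ^ (1 / lam - 2)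
            * (lam * M * |t - s|)) := by
            refine mul_le_mul (S.G_le η) (e1.trans ?_) (abs_nonneg _) zero_le_one
            exact mul_le_mul_of_nonneg_left (hst η) (by positivity)
        _ = _ := one_mul _)
  rw [sub_zero] at this
  calc _ ≤ _ := this
    _ = _ := by ring

/-- |U_ξ| ≤ |p|^(r-1) = X_ξ^(1-λ), and Hölder's inequality with exponents 1/λ and 1/(1-λ) applies.
The bound shows both that `U` is constant where the position is, and that it is Hölder in the
position. -/
lemma abs_sub_space_le (v₀ t : ℝ) {a b : ℝ} : |U b t - U a t| ≤
    |b - a| ^ lam * |charPos lam v₀ h p₀ G U t b - charPos lam v₀ h p₀ G U t a| ^ (1 - lam) := by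
  wlog hab : a ≤ b generalizing a b
  · rw [abs_sub_comm, abs_sub_comm b, abs_sub_comm (charPos _ _ _ _ _ _ _ b)]
    exact this (le_of_not_ge hab)
  have hr := S.two_le
  have hlam := S.lam_pos
  have h1l := S.one_sub_pos
  have hconj : Real.HolderConjugate (1 / lam) (1 / (1 - lam)) := by
    rw [Real.holderConjugate_iff]
    refine ⟨by linarith, by simp⟩
  have hnn : 0 ≤ ∫ η in a..b, charDens lam h p₀ G U t η :=
    intervalIntegral.integral_nonneg hab fun _ _ => charDens_nonneg _ _
  rw [S.charPos_sub, abs_of_nonneg hnn, abs_of_nonneg (sub_nonneg.2 hab), S.sub_eq_integral]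
  have hpm : Measurable fun η => |stretch lam h p₀ G U η t| ^ (1 / lam - 1) :=
    (continuous_abs_rpow (by linarith)).measurable.comp
      ((S.measurable_stretch S.cont).comp (measurable_id.prodMk measurable_const))
  have hle : |∫ η in a..b, G η * signedPow (1 / lam) (stretch lam h p₀ G U η t)|
      ≤ ∫ η in a..b, |stretch lam h p₀ G U η t| ^ (1 / lam - 1) := by
    rw [← Real.norm_eq_abs]
    refine intervalIntegral.norm_integral_le_of_norm_le
      (f := fun η => G η * signedPow (1 / lam) (stretch lam h p₀ G U η t))
      (g := fun η => |stretch lam h p₀ G U η t| ^ (1 / lam - 1)) hab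
      (Eventually.of_forall fun η _ => ?_)
      (intervalIntegrable_of_bounded (C := (1 + lam * M * |t|) ^ (1 / lam - 1)) hpm
        (fun η => ?_) _ _)
    · rw [norm_mul, Real.norm_eq_abs, Real.norm_eq_abs, abs_signedPow hr]
      exact mul_le_of_le_one_left (Real.rpow_nonneg (abs_nonneg _) _) (S.G_le η)
    · rw [abs_of_nonneg (Real.rpow_nonneg (abs_nonneg _) _)]
      exact Real.rpow_le_rpow (abs_nonneg _) (S.abs_stretch_le le_rfl) (by linarith)
  refine hle.trans ?_
  rw [intervalIntegral.integral_of_le hab, intervalIntegral.integral_of_le hab]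
  have hmem : MemLp (fun η => |stretch lam h p₀ G U η t| ^ (1 / lam - 1))
      (ENNReal.ofReal (1 / (1 - lam))) (volume.restrict (Ioc a b)) :=
    MemLp.of_bound hpm.aestronglyMeasurable ((1 + lam * M * |t|) ^ (1 / lam - 1))
      (Eventually.of_forall fun η => by
        rw [Real.norm_of_nonneg (Real.rpow_nonneg (abs_nonneg _) _)]
        exact Real.rpow_le_rpow (abs_nonneg _) (S.abs_stretch_le le_rfl) (by linarith))
  have := integral_mul_le_Lp_mul_Lq_of_nonneg hconj (μ := volume.restrict (Ioc a b))
    (f := fun _ => (1 : ℝ)) (g := fun η => |stretch lam h p₀ G U η t| ^ (1 / lam - 1))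
    (Eventually.of_forall fun _ => zero_le_one)
    (Eventually.of_forall fun η => Real.rpow_nonneg (abs_nonneg _) _) (memLp_const 1) hmem
  have e : ∀ η, (|stretch lam h p₀ G U η t| ^ (1 / lam - 1)) ^ (1 / (1 - lam))
      = charDens lam h p₀ G U t η := by
    intro η
    rw [← Real.rpow_mul (abs_nonneg _), charDens]
    congr 1
    field_simp
  simp only [one_mul, e, Real.one_rpow, one_div_one_div] at this
  simpa [hab] using this

end LagrangianSolution

/-! ### Return to Eulerian coordinates; continuity. -/

/-- The label of the characteristic passing through `x` at time `t`. -/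
noncomputable def charLabel (lam v₀ : ℝ) (h p₀ G : ℝ → ℝ) (U : ℝ → ℝ → ℝ) (t x : ℝ) : ℝ :=
  monoInv (charPos lam v₀ h p₀ G U t) x

/-- The solution in Eulerian coordinates. -/
noncomputable def eulerian (lam v₀ : ℝ) (h p₀ G : ℝ → ℝ) (U : ℝ → ℝ → ℝ) (x t : ℝ) : ℝ :=
  U (charLabel lam v₀ h p₀ G U t x) t

/-- The space derivative of the solution in Eulerian coordinates. -/
noncomputable def eulerianDeriv (lam v₀ : ℝ) (h p₀ G : ℝ → ℝ) (U : ℝ → ℝ → ℝ) (x t : ℝ) : ℝ :=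
  G (charLabel lam v₀ h p₀ G U t x) / stretch lam h p₀ G U (charLabel lam v₀ h p₀ G U t x) t

/-- A Lagrangian solution, at rest on the negative half-line, whose characteristics escape to
infinity uniformly on bounded time intervals. -/
structure ProperSolution (lam L M : ℝ) (F h p₀ G : ℝ → ℝ) (U : ℝ → ℝ → ℝ) : Prop
    extends LagrangianSolution lam L M F h p₀ G U where
  F_zero : 0 ≤ F 0
  p_neg : ∀ ξ < 0, p₀ ξ = 1
  G_neg : ∀ ξ < 0, G ξ = 0
  proper : ∀ T R, ∃ Ξ, ∀ t, |t| ≤ T → R ≤ charPos lam (F 0) h p₀ G U t Ξ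

namespace ProperSolution

variable {lam L M : ℝ} {F h p₀ G : ℝ → ℝ} {U : ℝ → ℝ → ℝ}
  (S : ProperSolution lam L M F h p₀ G U)
include S

lemma apply_of_nonpos {ξ : ℝ} (hξ : ξ ≤ 0) (t : ℝ) : U ξ t = 0 := by
  rw [S.eq, lagOp, intervalIntegral.integral_symm, intervalIntegral.integral_of_le hξ,
    integral_Ioc_eq_integral_Ioo, setIntegral_eq_zero_of_forall_eq_zero, neg_zero]
  intro η hη
  rw [S.G_neg η hη.2, zero_mul]

lemma charPos_of_nonpos {ξ : ℝ} (hξ : ξ ≤ 0) (t : ℝ) :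
    charPos lam (F 0) h p₀ G U t ξ = F 0 * t + ξ := by
  have : ∫ η in ξ..0, charDens lam h p₀ G U t η = ∫ η in ξ..0, (1 : ℝ) := by
    rw [intervalIntegral.integral_of_le hξ, intervalIntegral.integral_of_le hξ,
      integral_Ioc_eq_integral_Ioo, integral_Ioc_eq_integral_Ioo]
    refine setIntegral_congr_fun measurableSet_Ioo fun η hη => ?_
    simp [charDens, stretch, S.G_neg η hη.2, S.p_neg η hη.2]
  rw [charPos, intervalIntegral.integral_symm, this]
  simp

lemma tendsto_atTop (t : ℝ) : Tendsto (charPos lam (F 0) h p₀ G U t) atTop atTop := by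
  refine Filter.tendsto_atTop.2 fun R => ?_
  obtain ⟨Ξ, hΞ⟩ := S.proper |t| R
  filter_upwards [eventually_ge_atTop Ξ] with ξ hξ
  exact (hΞ t le_rfl).trans (S.monotone_charPos _ _ hξ)

lemma tendsto_atBot (t : ℝ) : Tendsto (charPos lam (F 0) h p₀ G U t) atBot atBot := by
  have h1 : Tendsto (fun ξ : ℝ => F 0 * t + ξ) atBot atBot :=
    tendsto_atBot_add_const_left _ _ tendsto_id
  refine h1.congr' ?_
  filter_upwards [eventually_le_atBot 0] with ξ hξ
  rw [S.charPos_of_nonpos hξ]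

lemma continuous_charPos_slice (t : ℝ) : Continuous (charPos lam (F 0) h p₀ G U t) :=
  (S.continuous_charPos (F 0)).comp (continuous_id.prodMk continuous_const)

lemma charPos_charLabel (t x : ℝ) :
    charPos lam (F 0) h p₀ G U t (charLabel lam (F 0) h p₀ G U t x) = x :=
  apply_monoInv (S.monotone_charPos _ t) (S.continuous_charPos_slice t) (S.tendsto_atTop t)
    (S.tendsto_atBot t) x

/-- The label at (x, t) is below c exactly when x < X(t, c), an open condition on (x, t). -/
lemma measurable_charLabel : Measurable fun z : ℝ × ℝ => charLabel lam (F 0) h p₀ G U z.2 z.1 := by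
  refine measurable_of_Iio fun c => ?_
  have : (fun z : ℝ × ℝ => charLabel lam (F 0) h p₀ G U z.2 z.1) ⁻¹' Iio c
      = {z | z.1 < charPos lam (F 0) h p₀ G U z.2 c} := by
    ext z
    exact monoInv_lt_iff (S.monotone_charPos _ z.2) (S.continuous_charPos_slice z.2)
      (S.tendsto_atTop z.2) (S.tendsto_atBot z.2)
  rw [this]
  exact (isOpen_lt continuous_fst ((S.continuous_charPos (F 0)).comp
    (continuous_const.prodMk continuous_snd))).measurableSet

/-- The selected label may differ from `ξ`, but both have the same position, and labels with equal
positions carry equal values by `abs_sub_space_le`. -/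
lemma eulerian_charPos (ξ t : ℝ) :
    eulerian lam (F 0) h p₀ G U (charPos lam (F 0) h p₀ G U t ξ) t = U ξ t := by
  have := S.abs_sub_space_le (F 0) t (a := ξ)
    (b := charLabel lam (F 0) h p₀ G U t (charPos lam (F 0) h p₀ G U t ξ))
  rw [S.charPos_charLabel, sub_self, abs_zero, Real.zero_rpow S.one_sub_pos.ne', mul_zero] at this
  exact sub_eq_zero.1 (abs_nonpos_iff.1 this)

/-- At time `t` the origin is occupied by the label `-(F 0 * t)`, which is nonpositive because `F 0
≥ 0` and therefore carries the value 0. -/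
lemma eulerian_zero {t : ℝ} (ht : 0 ≤ t) : eulerian lam (F 0) h p₀ G U 0 t = 0 := by
  have h0 : -(F 0 * t) ≤ 0 := by have := mul_nonneg S.F_zero ht; linarith
  have := S.eulerian_charPos (-(F 0 * t)) t
  rwa [S.charPos_of_nonpos h0, add_neg_cancel, S.apply_of_nonpos h0] at this

lemma measurable_eulerian : Measurable fun z : ℝ × ℝ => eulerian lam (F 0) h p₀ G U z.1 z.2 :=
  S.cont.measurable.comp (S.measurable_charLabel.prodMk measurable_snd)

lemma measurable_eulerianDeriv :
    Measurable fun z : ℝ × ℝ => eulerianDeriv lam (F 0) h p₀ G U z.1 z.2 :=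
  (S.meas_G.comp S.measurable_charLabel).div
    ((S.measurable_stretch S.cont).comp (S.measurable_charLabel.prodMk measurable_snd))

/-- Characteristics meeting a bounded part of the quarter plane have bounded labels. -/
lemma exists_label_bound (R : ℝ) : ∃ A, 0 ≤ A ∧ ∀ ξ t, t ∈ Icc 0 R →
    charPos lam (F 0) h p₀ G U t ξ ∈ Icc 0 R → |ξ| ≤ A := by
  -- The margin 1 places labels beyond `Ξ` strictly outside `[0, R]`.
  obtain ⟨Ξ, hΞ⟩ := S.proper R (R + 1)
  refine ⟨max |Ξ| (F 0 * R), le_max_of_le_left (abs_nonneg _), fun ξ t ht hx => ?_⟩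
  rcases le_total ξ 0 with h0 | h0
  · rw [S.charPos_of_nonpos h0] at hx
    rw [abs_of_nonpos h0]
    have := mul_le_mul_of_nonneg_left ht.2 S.F_zero
    exact le_max_of_le_right (by linarith [hx.1])
  · rw [abs_of_nonneg h0]
    refine le_max_of_le_left (le_trans ?_ (le_abs_self Ξ))
    by_contra! hlt
    have h1 := S.monotone_charPos (F 0) t hlt.le
    have h2 := hΞ t (by rw [abs_of_nonneg ht.1]; exact ht.2)
    linarith [hx.2]

/-- Joint local Hölder continuity. -/
lemma exists_holder (R : ℝ) : ∃ C, 0 ≤ C ∧ ∀ x ∈ Icc 0 R, ∀ t ∈ Icc 0 R, ∀ y ∈ Icc 0 R,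
    ∀ s ∈ Icc 0 R, |eulerian lam (F 0) h p₀ G U x t - eulerian lam (F 0) h p₀ G U y s|
      ≤ C * (max |x - y| |t - s|) ^ (1 - lam) := by
  obtain ⟨A, hA0, hA⟩ := S.exists_label_bound R
  have hFc : Continuous fun z : ℝ × ℝ => F (U z.1 z.2) := S.contDiff_F.continuous.comp S.cont
  obtain ⟨V, hV⟩ := ((isCompact_Icc (a := -A) (b := A)).prod
    (isCompact_Icc (a := -R) (b := R))).exists_bound_of_continuousOn hFc.continuousOn
  have hlam := S.lam_pos
  have h1l := S.one_sub_pos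
  have hM := S.M_nonneg
  have hr := S.two_le
  set W := max V 0 with hW
  have hW0 : 0 ≤ W := le_max_right _ _
  set K := (1 / lam - 1) * (1 + lam * M * R) ^ (1 / lam - 2) * (lam * M) * A with hK
  rcases lt_or_ge R 0 with hR | hR
  · refine ⟨0, le_rfl, fun x hx => ?_⟩
    exact absurd (hx.1.trans hx.2) (not_le.2 hR)
  have hK0 : 0 ≤ K := by
    have : 0 ≤ 1 / lam - 1 := by linarith
    positivity
  -- The two points are compared through the label of the first at the time of the second. The
  -- change in time is at most K d ≤ K R^λ d^(1-λ). For the change in space, the labels differ by at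
  -- most 2A and the positions by (W + 1) d, `W` bounding the speed.
  refine ⟨K * R ^ lam + (2 * A) ^ lam * (W + 1) ^ (1 - lam), by positivity,
    fun x hx t ht y hy s hs => ?_⟩
  set ξ := charLabel lam (F 0) h p₀ G U t x with hξ
  set η := charLabel lam (F 0) h p₀ G U s y with hη
  have hXξ : charPos lam (F 0) h p₀ G U t ξ = x := S.charPos_charLabel t x
  have hXη : charPos lam (F 0) h p₀ G U s η = y := S.charPos_charLabel s y
  have hξA : |ξ| ≤ A := hA ξ t ht (by rw [hXξ]; exact hx)
  have hηA : |η| ≤ A := hA η s hs (by rw [hXη]; exact hy)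
  have htR : |t| ≤ R := by rw [abs_of_nonneg ht.1]; exact ht.2
  have hsR : |s| ≤ R := by rw [abs_of_nonneg hs.1]; exact hs.2
  set d := max |x - y| |t - s| with hd
  have hd0 : 0 ≤ d := le_max_of_le_left (abs_nonneg _)
  have hdR : d ≤ R := max_le (abs_sub_le_iff.2 ⟨by linarith [hx.2, hy.1], by linarith [hy.2, hx.1]⟩)
    (abs_sub_le_iff.2 ⟨by linarith [ht.2, hs.1], by linarith [hs.2, ht.1]⟩)
  have htd : |t - s| ≤ d := le_max_right _ _
  have hxd : |x - y| ≤ d := le_max_left _ _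
  have e1 : |U ξ t - U ξ s| ≤ K * R ^ lam * d ^ (1 - lam) := by
    have hsplit : d = d ^ lam * d ^ (1 - lam) := by
      rw [← Real.rpow_add' hd0 (by norm_num)]; simp
    calc |U ξ t - U ξ s| ≤ _ := S.abs_sub_time_le hsR htR
      _ ≤ K * d := by
          rw [hK]
          have : 0 ≤ 1 / lam - 1 := by linarith
          gcongr
      _ = K * d ^ lam * d ^ (1 - lam) := by rw [mul_assoc K, ← hsplit]
      _ ≤ K * R ^ lam * d ^ (1 - lam) := by gcongr
  have e2 : |charPos lam (F 0) h p₀ G U s ξ - charPos lam (F 0) h p₀ G U t ξ| ≤ W * d := by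
    have := (convex_Icc (-R) R).norm_image_sub_le_of_norm_hasDerivWithin_le
      (f := fun t => charPos lam (F 0) h p₀ G U t ξ) (f' := fun t => F (U ξ t)) (C := W)
      (x := t) (y := s)
      (fun τ _ => (S.hasDerivAt_charPos ξ τ).hasDerivWithinAt)
      (fun τ hτ => (hV (ξ, τ) ⟨abs_le.1 hξA, hτ⟩).trans (le_max_left _ _))
      (abs_le.1 htR) (abs_le.1 hsR)
    rw [Real.norm_eq_abs, Real.norm_eq_abs, abs_sub_comm s t] at this
    exact this.trans (by gcongr)
  have e3 : |U ξ s - U η s| ≤ (2 * A) ^ lam * (W + 1) ^ (1 - lam) * d ^ (1 - lam) := by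
    have h2 : |charPos lam (F 0) h p₀ G U s ξ - charPos lam (F 0) h p₀ G U s η| ≤ (W + 1) * d := by
      rw [hXη]
      rw [hXξ] at e2
      calc |charPos lam (F 0) h p₀ G U s ξ - y|
          ≤ |charPos lam (F 0) h p₀ G U s ξ - x| + |x - y| := abs_sub_le _ _ _
        _ ≤ (W + 1) * d := by linarith
    have h3 : |ξ - η| ≤ 2 * A := by
      calc |ξ - η| ≤ |ξ| + |η| := abs_sub _ _
        _ ≤ 2 * A := by linarith
    calc |U ξ s - U η s| ≤ _ := S.abs_sub_space_le (F 0) s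
      _ ≤ (2 * A) ^ lam * ((W + 1) * d) ^ (1 - lam) := by gcongr
      _ = _ := by rw [Real.mul_rpow (by linarith) hd0]; ring
  calc |eulerian lam (F 0) h p₀ G U x t - eulerian lam (F 0) h p₀ G U y s|
      ≤ |U ξ t - U ξ s| + |U ξ s - U η s| := abs_sub_le _ _ _
    _ ≤ _ := by rw [add_mul]; exact add_le_add e1 e3

lemma holderOnWith (R : ℝ) : ∃ C : NNReal, HolderOnWith C (Real.toNNReal (1 - lam))
    (fun z : ℝ × ℝ => eulerian lam (F 0) h p₀ G U z.1 z.2) (Icc 0 R ×ˢ Icc 0 R) := by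
  obtain ⟨C, hC0, hC⟩ := S.exists_holder R
  refine ⟨C.toNNReal, fun z hz w hw => ?_⟩
  have := hC z.1 hz.1 z.2 hz.2 w.1 hw.1 w.2 hw.2
  rw [edist_dist, edist_dist, Real.dist_eq, Real.coe_toNNReal _ S.one_sub_pos.le,
    ENNReal.ofReal_rpow_of_nonneg dist_nonneg S.one_sub_pos.le, ← ENNReal.ofReal_coe_nnreal,
    Real.coe_toNNReal C hC0, ← ENNReal.ofReal_mul hC0, Prod.dist_eq, Real.dist_eq, Real.dist_eq]
  exact ENNReal.ofReal_le_ofReal this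

lemma continuousOn_eulerian :
    ContinuousOn (fun z : ℝ × ℝ => eulerian lam (F 0) h p₀ G U z.1 z.2) (Ici 0 ×ˢ Ici 0) := by
  intro z hz
  set R := max z.1 z.2 + 1 with hR
  obtain ⟨C, hC⟩ := S.holderOnWith R
  have hp : 0 < Real.toNNReal (1 - lam) := by simpa using S.one_sub_pos
  have h1 : z.1 < R := by have := le_max_left z.1 z.2; linarith
  have h2 : z.2 < R := by have := le_max_right z.1 z.2; linarith
  refine (hC.continuousOn hp z ⟨⟨hz.1, h1.le⟩, ⟨hz.2, h2.le⟩⟩).mono_of_mem_nhdsWithin ?_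
  rw [mem_nhdsWithin]
  exact ⟨Iio R ×ˢ Iio R, isOpen_Iio.prod isOpen_Iio, ⟨h1, h2⟩,
    fun w hw => ⟨⟨hw.2.1, (mem_Iio.1 hw.1.1).le⟩, ⟨hw.2.2, (mem_Iio.1 hw.1.2).le⟩⟩⟩

lemma holderOnWith_slice {t : ℝ} (ht : 0 ≤ t) (R : ℝ) : ∃ C : NNReal,
    HolderOnWith C (Real.toNNReal (1 - lam))
      (fun x => eulerian lam (F 0) h p₀ G U x t) (Icc 0 R) := by
  obtain ⟨C, hC⟩ := S.holderOnWith (max R t)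
  refine ⟨C, fun x hx y hy => ?_⟩
  have := hC (x, t) ⟨⟨hx.1, hx.2.trans (le_max_left _ _)⟩, ⟨ht, le_max_right _ _⟩⟩
    (y, t) ⟨⟨hy.1, hy.2.trans (le_max_left _ _)⟩, ⟨ht, le_max_right _ _⟩⟩
  simpa [Prod.edist_eq] using this

end ProperSolution

/-! ### Sobolev regularity in space. -/

lemma abs_rpow_eq_sq_mul {r : ℝ} (hr : 2 ≤ r) (p : ℝ) : |p| ^ r = p ^ 2 * |p| ^ (r - 2) := by
  rw [← sq_abs, ← Real.rpow_natCast, ← Real.rpow_add' (abs_nonneg p) (by push_cast; linarith)]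
  congr 1; push_cast; ring

namespace ProperSolution

variable {lam L M : ℝ} {F h p₀ G : ℝ → ℝ} {U : ℝ → ℝ → ℝ}
  (S : ProperSolution lam L M F h p₀ G U)
include S

/-- Labels are lost only where the position is flat, and there the density vanishes almost
everywhere. -/
lemma ae_charLabel (t : ℝ) : ∀ᵐ ξ, charDens lam h p₀ G U t ξ ≠ 0 →
    charLabel lam (F 0) h p₀ G U t (charPos lam (F 0) h p₀ G U t ξ) = ξ := by
  have := ae_monoInv_apply (LagrangianSolution.charDens_nonneg t) (S.intervalIntegrable_charDens t)
    (S.charPos_sub (F 0) t) (S.tendsto_atTop t) (S.tendsto_atBot t)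
  rw [densMeasure, ae_withDensity_iff (S.measurable_charDens_slice t).ennreal_ofReal] at this
  filter_upwards [this] with ξ hξ h0
  refine hξ ?_
  rw [Ne, ENNReal.ofReal_eq_zero, not_le]
  exact lt_of_le_of_ne (LagrangianSolution.charDens_nonneg t ξ) (Ne.symm h0)

lemma charDens_ne_zero {t ξ : ℝ} (hp : stretch lam h p₀ G U ξ t ≠ 0) :
    charDens lam h p₀ G U t ξ ≠ 0 := by
  have := S.two_le
  rw [charDens, Ne, Real.rpow_eq_zero (abs_nonneg _) (by linarith), abs_eq_zero]
  exact hp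

lemma charDens_eq_zero {t ξ : ℝ} (hp : stretch lam h p₀ G U ξ t = 0) :
    charDens lam h p₀ G U t ξ = 0 := by
  rw [charDens, hp, abs_zero, Real.zero_rpow (by linarith [S.two_le])]

/-- Off the zeros of p this is |p|^r G/p. At a zero the density kills the value of `eulerianDeriv`,
whatever it is. -/
lemma charDens_mul_eulerianDeriv {t ξ : ℝ} (hξ : charDens lam h p₀ G U t ξ ≠ 0 →
    charLabel lam (F 0) h p₀ G U t (charPos lam (F 0) h p₀ G U t ξ) = ξ) :
    charDens lam h p₀ G U t ξ
        * eulerianDeriv lam (F 0) h p₀ G U (charPos lam (F 0) h p₀ G U t ξ) t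
      = G ξ * signedPow (1 / lam) (stretch lam h p₀ G U ξ t) := by
  by_cases hp : stretch lam h p₀ G U ξ t = 0
  · rw [S.charDens_eq_zero hp, hp]; simp [signedPow]
  · rw [eulerianDeriv, hξ (S.charDens_ne_zero hp), charDens, abs_rpow_eq_sq_mul S.two_le,
      signedPow]
    field_simp

lemma lintegral_slice {t : ℝ} {f : ℝ → ENNReal} (hf : Measurable f) :
    ∫⁻ ξ, ENNReal.ofReal (charDens lam h p₀ G U t ξ) * f (charPos lam (F 0) h p₀ G U t ξ)
      = ∫⁻ x, f x :=
  lintegral_comp_mul_density (LagrangianSolution.charDens_nonneg t)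
    (S.intervalIntegrable_charDens t) (S.charPos_sub (F 0) t) (S.tendsto_atTop t)
    (S.tendsto_atBot t) (S.measurable_charDens_slice t) hf

lemma memLpLoc_eulerian {t : ℝ} (ht : 0 ≤ t) :
    MemLpLocHalfLine (1 / lam) (fun x => eulerian lam (F 0) h p₀ G U x t) := by
  intro R
  have hc : ContinuousOn (fun x => eulerian lam (F 0) h p₀ G U x t) (Icc 0 R) :=
    S.continuousOn_eulerian.comp (f := fun x => (x, t)) (by fun_prop) fun x hx => ⟨hx.1, ht⟩
  obtain ⟨C, hC⟩ := isCompact_Icc.exists_bound_of_continuousOn hc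
  exact MemLp.of_bound (hc.aestronglyMeasurable measurableSet_Icc) C
    ((ae_restrict_iff' measurableSet_Icc).2 (Eventually.of_forall hC))

/-- In label coordinates |u_x|^r dx becomes |p|^r |G/p|^r dξ, at most dξ; the energy on `[0, R]` is
bounded by the length of the labels found there. -/
lemma memLpLoc_eulerianDeriv {t : ℝ} (ht : 0 ≤ t) :
    MemLpLocHalfLine (1 / lam) (fun x => eulerianDeriv lam (F 0) h p₀ G U x t) := by
  intro R
  have hr := S.two_le
  have hm : Measurable fun x => eulerianDeriv lam (F 0) h p₀ G U x t :=
    S.measurable_eulerianDeriv.comp (measurable_id.prodMk measurable_const)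
  refine ⟨hm.aestronglyMeasurable, ?_⟩
  rw [eLpNorm_lt_top_iff_lintegral_rpow_enorm_lt_top (by simpa using S.lam_pos)
    ENNReal.ofReal_ne_top, ENNReal.toReal_ofReal (by linarith),
    ← lintegral_indicator measurableSet_Icc, ← S.lintegral_slice (t := t)
      ((hm.enorm.pow_const _).indicator measurableSet_Icc)]
  obtain ⟨A, hA0, hA⟩ := S.exists_label_bound (max R t)
  refine lt_of_le_of_lt (lintegral_mono_ae (g := (Icc (-A) A).indicator fun _ => 1) ?_) ?_
  · filter_upwards [S.ae_charLabel t] with ξ hξ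
    by_cases hx : charPos lam (F 0) h p₀ G U t ξ ∈ Icc 0 R
    · have hξA : ξ ∈ Icc (-A) A := abs_le.1 (hA ξ t ⟨ht, le_max_right _ _⟩
        ⟨hx.1, hx.2.trans (le_max_left _ _)⟩)
      rw [indicator_of_mem hx, indicator_of_mem hξA]
      by_cases hp : stretch lam h p₀ G U ξ t = 0
      · rw [S.charDens_eq_zero hp]; simp
      · rw [eulerianDeriv, hξ (S.charDens_ne_zero hp), Real.enorm_eq_ofReal_abs,
          ENNReal.ofReal_rpow_of_nonneg (abs_nonneg _) (by linarith),
          ← ENNReal.ofReal_mul (LagrangianSolution.charDens_nonneg _ _), charDens, abs_div,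
          ← Real.mul_rpow (abs_nonneg _) (by positivity), mul_div_cancel₀ _ (abs_ne_zero.2 hp)]
        rw [ENNReal.ofReal_le_one]
        exact Real.rpow_le_one (abs_nonneg _) (S.G_le ξ) (by linarith)
    · rw [indicator_of_notMem hx]; simp
  · rw [lintegral_indicator measurableSet_Icc]
    simp

/-- After substituting x = X(t, ξ), this is integration by parts in ξ, where `U` and X are
primitives of bounded functions. -/
lemma isWeakDeriv_eulerian {t : ℝ} :
    IsWeakDerivHalfLine (fun x => eulerian lam (F 0) h p₀ G U x t)
      (fun x => eulerianDeriv lam (F 0) h p₀ G U x t) := by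
  intro ψ hψ hc hs
  obtain ⟨ε, R, hε, hεR, hsub⟩ := exists_Icc_of_tsupport hc hs
  have h0 : ∀ x, x ∉ Icc ε R → ψ x = 0 := fun x hx =>
    image_eq_zero_of_notMem_tsupport fun h => hx (hsub h)
  have h0' : ∀ x, x ∉ Icc ε R → deriv ψ x = 0 := fun x hx => by
    by_contra h
    exact hx (hsub ((tsupport_deriv_subset (𝕜 := ℝ)) (subset_tsupport _ h)))
  have hdc : Continuous (deriv ψ) := hψ.continuous_deriv (by simp)
  have hIoi : ∀ x, x ∉ Ioi (0 : ℝ) → x ∉ Icc ε R := fun x hx hx' => hx (hε.trans_le hx'.1)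
  rw [setIntegral_eq_integral_of_forall_compl_eq_zero
      fun x hx => by rw [h0' x (hIoi x hx), mul_zero],
    setIntegral_eq_integral_of_forall_compl_eq_zero
      fun x hx => by rw [h0 x (hIoi x hx), mul_zero]]
  have hme : Measurable fun x => eulerian lam (F 0) h p₀ G U x t :=
    S.measurable_eulerian.comp (measurable_id.prodMk measurable_const)
  have hmd : Measurable fun x => eulerianDeriv lam (F 0) h p₀ G U x t :=
    S.measurable_eulerianDeriv.comp (measurable_id.prodMk measurable_const)
  have cv : ∀ f : ℝ → ℝ, Measurable f → ∫ ξ, charDens lam h p₀ G U t ξ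
      * f (charPos lam (F 0) h p₀ G U t ξ) = ∫ x, f x := fun f hf =>
    integral_comp_mul_density (LagrangianSolution.charDens_nonneg t)
      (S.intervalIntegrable_charDens t) (S.charPos_sub (F 0) t) (S.tendsto_atTop t)
      (S.tendsto_atBot t) (S.measurable_charDens_slice t) hf
  rw [← cv (fun x => eulerian lam (F 0) h p₀ G U x t * deriv ψ x) (hme.mul hdc.measurable),
    ← cv (fun x => eulerianDeriv lam (F 0) h p₀ G U x t * ψ x)
      (hmd.mul hψ.continuous.measurable)]
  have e1 : ∀ ξ, charDens lam h p₀ G U t ξ * (eulerian lam (F 0) h p₀ G U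
      (charPos lam (F 0) h p₀ G U t ξ) t * deriv ψ (charPos lam (F 0) h p₀ G U t ξ))
      = U ξ t * (deriv ψ (charPos lam (F 0) h p₀ G U t ξ) * charDens lam h p₀ G U t ξ) := by
    intro ξ
    rw [S.eulerian_charPos]; ring
  have e2 : ∀ᵐ ξ, charDens lam h p₀ G U t ξ * (eulerianDeriv lam (F 0) h p₀ G U
      (charPos lam (F 0) h p₀ G U t ξ) t * ψ (charPos lam (F 0) h p₀ G U t ξ))
      = G ξ * signedPow (1 / lam) (stretch lam h p₀ G U ξ t)
        * ψ (charPos lam (F 0) h p₀ G U t ξ) := by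
    filter_upwards [S.ae_charLabel t] with ξ hξ
    rw [← mul_assoc, S.charDens_mul_eulerianDeriv hξ]
  rw [integral_congr_ae e2, integral_congr_ae (Eventually.of_forall e1)]
  obtain ⟨a, ha⟩ := ((S.tendsto_atBot t).eventually_lt_atBot ε).exists
  obtain ⟨b, hb⟩ := ((S.tendsto_atTop t).eventually_gt_atTop R).exists
  have hmono := S.monotone_charPos (F 0) t
  have hab : a ≤ b := by
    by_contra! hlt
    linarith [hmono hlt.le]
  have hout : ∀ ξ, ξ ∉ Ioc a b → charPos lam (F 0) h p₀ G U t ξ ∉ Icc ε R := by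
    intro ξ hξ hx
    refine hξ ⟨?_, ?_⟩
    · by_contra! h'; linarith [hmono h', hx.1]
    · by_contra! h'; linarith [hmono h'.le, hx.2]
  have toI : ∀ f : ℝ → ℝ, (∀ ξ, ξ ∉ Ioc a b → f ξ = 0) → ∫ ξ, f ξ = ∫ ξ in a..b, f ξ :=
    fun f hf => by
      rw [intervalIntegral.integral_of_le hab, setIntegral_eq_integral_of_forall_compl_eq_zero hf]
  rw [toI _ fun ξ hξ => by rw [h0' _ (hout ξ hξ)]; ring,
    toI _ fun ξ hξ => by rw [h0 _ (hout ξ hξ)]; ring]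
  have hparts := integral_primitive_mul_comp (hψ.of_le (by simp)) (S.measurable_charDens_slice t)
    (fun ξ => S.abs_charDens_le (le_refl |t|) ξ) (S.charPos_sub (F 0) t)
    (S.measurable_slope_slice S.cont t) (fun ξ => S.abs_slope_le (le_refl |t|))
    (fun a b => S.sub_eq_integral t a b) a b
  have i1 := (S.intervalIntegrable_slope S.cont t a b).mul_continuousOn
    (hψ.continuous.comp (S.continuous_charPos_slice t)).continuousOn
  have i2 := ((S.intervalIntegrable_charDens t a b).continuousOn_mul
    (hdc.comp (S.continuous_charPos_slice t)).continuousOn).continuousOn_mul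
    (S.cont.comp (continuous_id.prodMk (continuous_const (y := t)))).continuousOn
  have hsplit := intervalIntegral.integral_add i1 i2
  simp only [Function.comp_apply, id_eq, Function.uncurry_apply_pair] at hsplit
  rw [hsplit, h0 _ (fun h => by linarith [h.1] : charPos lam (F 0) h p₀ G U t a ∉ Icc ε R),
    h0 _ (fun h => by linarith [h.2] : charPos lam (F 0) h p₀ G U t b ∉ Icc ε R)] at hparts
  linarith

lemma isW1pLocDeriv_eulerian {t : ℝ} (ht : 0 ≤ t) :
    IsW1pLocDeriv (1 / lam) (fun x => eulerian lam (F 0) h p₀ G U x t)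
      (fun x => eulerianDeriv lam (F 0) h p₀ G U x t) :=
  ⟨S.memLpLoc_eulerian ht, S.memLpLoc_eulerianDeriv ht, S.isWeakDeriv_eulerian⟩

end ProperSolution

/-! ### The weak equation. -/

namespace IsTestFunction

variable {φ : ℝ × ℝ → ℝ} (hφ : IsTestFunction φ)
include hφ

lemma deriv_time (z : ℝ × ℝ) : deriv (fun s => φ (z.1, s)) z.2 = fderiv ℝ φ z (0, 1) := by
  have h1 : HasFDerivAt φ (fderiv ℝ φ z) (z.1, z.2) :=
    (hφ.1.differentiable (by simp) z).hasFDerivAt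
  exact (h1.comp_hasDerivAt z.2 ((hasDerivAt_const z.2 z.1).prodMk (hasDerivAt_id z.2))).deriv

lemma deriv_space (z : ℝ × ℝ) : deriv (fun y => φ (y, z.2)) z.1 = fderiv ℝ φ z (1, 0) := by
  have h1 : HasFDerivAt φ (fderiv ℝ φ z) (z.1, z.2) :=
    (hφ.1.differentiable (by simp) z).hasFDerivAt
  exact (h1.comp_hasDerivAt z.1 ((hasDerivAt_id z.1).prodMk (hasDerivAt_const z.1 z.2))).deriv

lemma hasDerivAt_comp {x : ℝ → ℝ} {v t : ℝ} (hx : HasDerivAt x v t) :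
    HasDerivAt (fun t => φ (x t, t))
      (fderiv ℝ φ (x t, t) (0, 1) + v * fderiv ℝ φ (x t, t) (1, 0)) t := by
  have h1 : HasFDerivAt φ (fderiv ℝ φ (x t, t)) (x t, t) :=
    (hφ.1.differentiable (by simp) _).hasFDerivAt
  have h2 := HasFDerivAt.comp_hasDerivAt (f := fun t => (x t, t)) t h1
    (hx.prodMk (hasDerivAt_id t))
  have h3 : ((v, 1) : ℝ × ℝ) = (0, 1) + v • (1, 0) := by simp
  rw [h3, map_add, map_smul, smul_eq_mul] at h2
  exact h2

lemma continuous_fderiv_apply (w : ℝ × ℝ) : Continuous fun z => fderiv ℝ φ z w :=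
  (hφ.1.continuous_fderiv (by simp)).clm_apply continuous_const

omit hφ in
lemma fderiv_eq_zero {z : ℝ × ℝ} (hz : z ∉ tsupport φ) : fderiv ℝ φ z = 0 := by
  by_contra h
  exact hz (support_fderiv_subset ℝ h)

lemma exists_bound : ∃ R, 0 ≤ R ∧ tsupport φ ⊆ Icc 0 R ×ˢ Icc 0 R := by
  obtain ⟨R, hR⟩ := (IsCompact.isBounded hφ.2.1).subset_closedBall 0
  refine ⟨max R 0, le_max_right _ _, fun z hz => ?_⟩
  have h1 := hR hz
  have h2 := hφ.2.2 hz
  rw [mem_closedBall_zero_iff, Prod.norm_def, max_le_iff] at h1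
  exact ⟨⟨h2.1.le, ((le_abs_self _).trans h1.1).trans (le_max_left _ _)⟩,
    ⟨h2.2.le, ((le_abs_self _).trans h1.2).trans (le_max_left _ _)⟩⟩

end IsTestFunction

/-- The weak integrand in Lagrangian coordinates. -/
noncomputable def lagIntegrand (lam : ℝ) (F h p₀ G : ℝ → ℝ) (U : ℝ → ℝ → ℝ) (φ : ℝ × ℝ → ℝ)
    (ξ t : ℝ) : ℝ :=
  -(G ξ * signedPow (1 / lam) (stretch lam h p₀ G U ξ t))
      * (fderiv ℝ φ (charPos lam (F 0) h p₀ G U t ξ, t) (0, 1)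
        + F (U ξ t) * fderiv ℝ φ (charPos lam (F 0) h p₀ G U t ξ, t) (1, 0))
    + (lam - 1) * h (U ξ t) * (G ξ ^ 2 * |stretch lam h p₀ G U ξ t| ^ (1 / lam - 2))
      * φ (charPos lam (F 0) h p₀ G U t ξ, t)

namespace ProperSolution

variable {lam L M : ℝ} {F h p₀ G : ℝ → ℝ} {U : ℝ → ℝ → ℝ}
  (S : ProperSolution lam L M F h p₀ G U)
include S

lemma continuous_charMap :
    Continuous fun z : ℝ × ℝ => (charPos lam (F 0) h p₀ G U z.2 z.1, z.2) :=
  (S.continuous_charPos (F 0)).prodMk continuous_snd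

/-- The map preserves time, so by Tonelli's theorem the claim reduces to the one-dimensional change
of variables at each fixed time. -/
lemma map_charMap : (volume.withDensity
    fun z : ℝ × ℝ => ENNReal.ofReal (charDens lam h p₀ G U z.2 z.1)).map
      (fun z : ℝ × ℝ => (charPos lam (F 0) h p₀ G U z.2 z.1, z.2)) = volume := by
  have hq : Measurable fun z : ℝ × ℝ => ENNReal.ofReal (charDens lam h p₀ G U z.2 z.1) :=
    S.measurable_charDens.ennreal_ofReal
  refine Measure.ext_of_lintegral _ fun f hf => ?_
  have hfc : Measurable fun z : ℝ × ℝ => f (charPos lam (F 0) h p₀ G U z.2 z.1, z.2) :=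
    hf.comp S.continuous_charMap.measurable
  rw [lintegral_map hf S.continuous_charMap.measurable,
    lintegral_withDensity_eq_lintegral_mul _ hq hfc, Measure.volume_eq_prod,
    lintegral_prod_symm' _ (hq.mul hfc), lintegral_prod_symm' _ hf]
  refine lintegral_congr fun t => ?_
  exact S.lintegral_slice (t := t) (hf.comp (measurable_id.prodMk measurable_const))

lemma ae_charLabel_prod : ∀ᵐ z : ℝ × ℝ, charDens lam h p₀ G U z.2 z.1 ≠ 0 →
    charLabel lam (F 0) h p₀ G U z.2 (charPos lam (F 0) h p₀ G U z.2 z.1) = z.1 := by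
  have hs : MeasurableSet {z : ℝ × ℝ | charDens lam h p₀ G U z.1 z.2 ≠ 0 →
      charLabel lam (F 0) h p₀ G U z.1 (charPos lam (F 0) h p₀ G U z.1 z.2) = z.2} := by
    have m1 : MeasurableSet {z : ℝ × ℝ | charDens lam h p₀ G U z.1 z.2 ≠ 0} :=
      ((S.measurable_charDens.comp measurable_swap) (measurableSet_singleton 0)).compl
    have m2 : MeasurableSet {z : ℝ × ℝ |
        charLabel lam (F 0) h p₀ G U z.1 (charPos lam (F 0) h p₀ G U z.1 z.2) = z.2} :=
      measurableSet_eq_fun ((S.measurable_charLabel.comp S.continuous_charMap.measurable).comp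
        measurable_swap) measurable_snd
    exact m1.imp m2
  have h1 : ∀ᵐ z : ℝ × ℝ ∂(volume.prod volume), charDens lam h p₀ G U z.1 z.2 ≠ 0 →
      charLabel lam (F 0) h p₀ G U z.1 (charPos lam (F 0) h p₀ G U z.1 z.2) = z.2 :=
    (Measure.ae_prod_iff_ae_ae hs).2 (Eventually.of_forall fun t => S.ae_charLabel t)
  exact Measure.measurePreserving_swap.quasiMeasurePreserving.ae h1

/-- Needed when λ = 1/2: then |p|^(r-2) = 1 even at zeros of p, whereas the Eulerian side has
density 0 there. Since λ G h(U) is the time derivative of p, it vanishes at almost every zero of p,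
and the two sides agree. -/
lemma ae_stretch_prod : ∀ᵐ z : ℝ × ℝ, stretch lam h p₀ G U z.1 z.2 = 0 →
    lam * G z.1 * h (U z.1 z.2) = 0 := by
  have hs : MeasurableSet {z : ℝ × ℝ | stretch lam h p₀ G U z.1 z.2 = 0 →
      lam * G z.1 * h (U z.1 z.2) = 0} := by
    have m1 : MeasurableSet {z : ℝ × ℝ | stretch lam h p₀ G U z.1 z.2 = 0} :=
      (S.measurable_stretch S.cont) (measurableSet_singleton 0)
    have hm : Measurable fun z : ℝ × ℝ => lam * G z.1 * h (U z.1 z.2) :=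
      ((S.meas_G.comp measurable_fst).const_mul lam).mul (S.continuous_h.comp S.cont).measurable
    exact m1.imp (hm (measurableSet_singleton 0))
  exact (Measure.ae_prod_iff_ae_ae hs).2 (Eventually.of_forall fun ξ =>
    ae_deriv_eq_zero_of_eq_zero (S.hasDerivAt_stretch S.cont ξ))

lemma hasDerivAt_slope (ξ t : ℝ) :
    HasDerivAt (fun t => G ξ * signedPow (1 / lam) (stretch lam h p₀ G U ξ t))
      ((1 - lam) * h (U ξ t) * (G ξ ^ 2 * |stretch lam h p₀ G U ξ t| ^ (1 / lam - 2))) t := by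
  have h1 := (((hasDerivAt_signedPow S.two_le (stretch lam h p₀ G U ξ t)).comp t
    (S.hasDerivAt_stretch S.cont ξ t))).const_mul (G ξ)
  convert! h1 using 1
  have := S.lam_pos
  field_simp

variable {φ : ℝ × ℝ → ℝ} (hφ : IsTestFunction φ)
include hφ

/-- The derivative of φ(X, t) along a characteristic is φ_t + F(U) φ_x. As (r-1) λ = 1-λ,
differentiating U_ξ yields precisely the quadratic term of the weak form. -/
lemma hasDerivAt_slope_mul_test (ξ t : ℝ) :
    HasDerivAt (fun t => -(G ξ * signedPow (1 / lam) (stretch lam h p₀ G U ξ t)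
      * φ (charPos lam (F 0) h p₀ G U t ξ, t))) (lagIntegrand lam F h p₀ G U φ ξ t) t := by
  have := ((S.hasDerivAt_slope ξ t).mul (hφ.hasDerivAt_comp (S.hasDerivAt_charPos ξ t))).neg
  convert! this using 1
  unfold lagIntegrand
  ring

lemma measurable_lagIntegrand :
    Measurable fun z : ℝ × ℝ => lagIntegrand lam F h p₀ G U φ z.1 z.2 := by
  have hm := S.continuous_charMap
  have hr : 0 ≤ 1 / lam - 2 := by linarith [S.two_le]
  refine ((S.measurable_slope S.cont).neg.mul (Continuous.measurable ?_)).add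
    (((Continuous.measurable ?_).mul (((S.meas_G.comp measurable_fst).pow_const 2).mul
      ((continuous_abs_rpow hr).measurable.comp (S.measurable_stretch S.cont)))).mul
        (Continuous.measurable ?_))
  · exact ((hφ.continuous_fderiv_apply (0, 1)).comp hm).add
      ((S.contDiff_F.continuous.comp S.cont).mul ((hφ.continuous_fderiv_apply (1, 0)).comp hm))
  · exact continuous_const.mul (S.continuous_h.comp S.cont)
  · exact hφ.1.continuous.comp hm

lemma integrable_lagIntegrand :
    Integrable fun z : ℝ × ℝ => lagIntegrand lam F h p₀ G U φ z.1 z.2 := by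
  obtain ⟨R, hR0, hR⟩ := hφ.exists_bound
  obtain ⟨A, hA0, hA⟩ := S.exists_label_bound R
  set K : Set (ℝ × ℝ) := Icc (-A) A ×ˢ Icc 0 R with hK
  have hKc : IsCompact K := isCompact_Icc.prod isCompact_Icc
  have hm := S.continuous_charMap
  have hr : 0 ≤ 1 / lam - 2 := by linarith [S.two_le]
  have hsupp : Function.support (fun z : ℝ × ℝ => lagIntegrand lam F h p₀ G U φ z.1 z.2) ⊆ K := by
    intro z hz
    by_contra hzK
    refine hz ?_
    have hout : (charPos lam (F 0) h p₀ G U z.2 z.1, z.2) ∉ tsupport φ := fun hin =>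
      hzK ⟨abs_le.1 (hA z.1 z.2 (hR hin).2 (hR hin).1), (hR hin).2⟩
    simp only [lagIntegrand]
    rw [IsTestFunction.fderiv_eq_zero hout, image_eq_zero_of_notMem_tsupport hout]
    simp
  obtain ⟨C₁, hC₁⟩ := hKc.exists_bound_of_continuousOn (Continuous.continuousOn
    (((hφ.continuous_fderiv_apply (0, 1)).comp hm).add
      ((S.contDiff_F.continuous.comp S.cont).mul ((hφ.continuous_fderiv_apply (1, 0)).comp hm))))
  obtain ⟨C₂, hC₂⟩ := hKc.exists_bound_of_continuousOn (Continuous.continuousOn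
    (((continuous_const (y := lam - 1)).mul (S.continuous_h.comp S.cont)).mul
      (hφ.1.continuous.comp hm)))
  rw [← integrableOn_iff_integrable_of_support_subset hsupp]
  refine Measure.integrableOn_of_bounded (M := (1 + lam * M * R) ^ (1 / lam - 1) * C₁
    + (1 + lam * M * R) ^ (1 / lam - 2) * C₂) hKc.measure_ne_top
    (S.measurable_lagIntegrand hφ).aestronglyMeasurable
    ((ae_restrict_iff' hKc.measurableSet).2 (Eventually.of_forall fun z hz => ?_))
  have ht : |z.2| ≤ R := by rw [abs_of_nonneg hz.2.1]; exact hz.2.2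
  have b1 := S.abs_slope_le (U := U) (ξ := z.1) ht
  have b2 := S.abs_stretch_le (U := U) (ξ := z.1) ht
  have b3 : |G z.1 ^ 2 * |stretch lam h p₀ G U z.1 z.2| ^ (1 / lam - 2)|
      ≤ (1 + lam * M * R) ^ (1 / lam - 2) := by
    rw [abs_mul, abs_of_nonneg (Real.rpow_nonneg (abs_nonneg _) _), abs_pow]
    calc |G z.1| ^ 2 * |stretch lam h p₀ G U z.1 z.2| ^ (1 / lam - 2)
        ≤ 1 * (1 + lam * M * R) ^ (1 / lam - 2) := by
          have := pow_le_one₀ (n := 2) (abs_nonneg _) (S.G_le z.1)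
          gcongr
      _ = _ := one_mul _
  have b4 := hC₁ z hz
  have b5 := hC₂ z hz
  have hB := S.bound_pos hR0
  rw [Real.norm_eq_abs] at b4 b5 ⊢
  refine (abs_add_le _ _).trans (add_le_add ?_ ?_)
  · rw [abs_mul, abs_neg]
    exact mul_le_mul b1 b4 (abs_nonneg _) (by positivity)
  · rw [mul_right_comm, mul_comm _ (G z.1 ^ 2 * _), abs_mul]
    exact mul_le_mul b3 b5 (abs_nonneg _) (by positivity)

/-- By Fubini, integrate first in time: for almost every label this is the integral of the
derivative of a compactly supported function. -/
lemma integral_lagIntegrand : ∫ z : ℝ × ℝ, lagIntegrand lam F h p₀ G U φ z.1 z.2 = 0 := by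
  have hi := S.integrable_lagIntegrand hφ
  rw [Measure.volume_eq_prod] at hi ⊢
  rw [integral_prod _ hi]
  refine integral_eq_zero_of_ae ?_
  filter_upwards [hi.prod_right_ae] with ξ hξ
  obtain ⟨R, hR0, hR⟩ := hφ.exists_bound
  refine integral_eq_zero_of_hasDerivAt_of_integrable (S.hasDerivAt_slope_mul_test hφ ξ) hξ ?_
  refine Continuous.integrable_of_hasCompactSupport (continuous_iff_continuousAt.2 fun t =>
    (S.hasDerivAt_slope_mul_test hφ ξ t).continuousAt) ?_
  refine HasCompactSupport.of_support_subset_isCompact (isCompact_Icc (a := 0) (b := R))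
    fun t ht => ?_
  by_contra htR
  refine ht ?_
  simp only
  rw [image_eq_zero_of_notMem_tsupport fun hin => htR (hR hin).2]
  simp

lemma ae_weakIntegrand (f : ℝ → ℝ) (hF : F = deriv f) (hh : h = deriv (deriv f)) :
    ∀ᵐ z : ℝ × ℝ, charDens lam h p₀ G U z.2 z.1 *
      weakIntegrand lam f (eulerian lam (F 0) h p₀ G U) (eulerianDeriv lam (F 0) h p₀ G U) φ
        (charPos lam (F 0) h p₀ G U z.2 z.1, z.2) = lagIntegrand lam F h p₀ G U φ z.1 z.2 := by
  filter_upwards [S.ae_charLabel_prod, S.ae_stretch_prod] with z hz hz'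
  have e1 := S.charDens_mul_eulerianDeriv hz
  have e2 : (lam - 1) * h (U z.1 z.2) * (charDens lam h p₀ G U z.2 z.1 *
      eulerianDeriv lam (F 0) h p₀ G U (charPos lam (F 0) h p₀ G U z.2 z.1) z.2 ^ 2)
      = (lam - 1) * h (U z.1 z.2)
        * (G z.1 ^ 2 * |stretch lam h p₀ G U z.1 z.2| ^ (1 / lam - 2)) := by
    by_cases hp : stretch lam h p₀ G U z.1 z.2 = 0
    · have h0 := hz' hp
      rw [S.charDens_eq_zero hp]
      have hlam := S.lam_pos.ne'
      have h0' : h (U z.1 z.2) * G z.1 = 0 := by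
        have := (mul_eq_zero.1 ((mul_assoc _ _ _).symm.trans h0)).resolve_left hlam
        rw [mul_comm]; exact this
      calc _ = 0 := by ring
        _ = (lam - 1) * (h (U z.1 z.2) * G z.1) * G z.1
          * |stretch lam h p₀ G U z.1 z.2| ^ (1 / lam - 2) := by rw [h0']; ring
        _ = _ := by ring
    · congr 1
      rw [eulerianDeriv, hz (S.charDens_ne_zero hp), charDens, abs_rpow_eq_sq_mul S.two_le]
      field_simp
  simp only [weakIntegrand]
  rw [hφ.deriv_time (charPos lam (F 0) h p₀ G U z.2 z.1, z.2),
    hφ.deriv_space (charPos lam (F 0) h p₀ G U z.2 z.1, z.2), S.eulerian_charPos, ← hh, ← hF,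
    lagIntegrand, ← e1, ← e2]
  ring

lemma measurable_weakIntegrand (f : ℝ → ℝ) (hF : F = deriv f) (hh : h = deriv (deriv f)) :
    Measurable (weakIntegrand lam f (eulerian lam (F 0) h p₀ G U)
      (eulerianDeriv lam (F 0) h p₀ G U) φ) := by
  have hU := S.measurable_eulerian
  have hd := S.measurable_eulerianDeriv
  have e : weakIntegrand lam f (eulerian lam (F 0) h p₀ G U) (eulerianDeriv lam (F 0) h p₀ G U) φ
      = fun z => -eulerianDeriv lam (F 0) h p₀ G U z.1 z.2 * (fderiv ℝ φ z (0, 1)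
        + F (eulerian lam (F 0) h p₀ G U z.1 z.2) * fderiv ℝ φ z (1, 0))
        + (lam - 1) * h (eulerian lam (F 0) h p₀ G U z.1 z.2)
          * (eulerianDeriv lam (F 0) h p₀ G U z.1 z.2) ^ 2 * φ z := by
    ext z
    rw [weakIntegrand, hφ.deriv_time, hφ.deriv_space, ← hh, ← hF]
  rw [e]
  exact (hd.neg.mul ((hφ.continuous_fderiv_apply (0, 1)).measurable.add
    ((S.contDiff_F.continuous.measurable.comp hU).mul
      (hφ.continuous_fderiv_apply (1, 0)).measurable))).add
    ((((S.continuous_h.measurable.comp hU).const_mul (lam - 1)).mul (hd.pow_const 2)).mul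
      hφ.1.continuous.measurable)

lemma weak_equation (f : ℝ → ℝ) (hF : F = deriv f) (hh : h = deriv (deriv f)) :
    IntegrableOn (weakIntegrand lam f (eulerian lam (F 0) h p₀ G U)
      (eulerianDeriv lam (F 0) h p₀ G U) φ) quarterPlane ∧
    ∫ z in quarterPlane, weakIntegrand lam f (eulerian lam (F 0) h p₀ G U)
      (eulerianDeriv lam (F 0) h p₀ G U) φ z = 0 := by
  set W := weakIntegrand lam f (eulerian lam (F 0) h p₀ G U)
    (eulerianDeriv lam (F 0) h p₀ G U) φ with hW
  have hWm : Measurable W := S.measurable_weakIntegrand hφ f hF hh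
  have hq : Measurable fun z : ℝ × ℝ => ENNReal.ofReal (charDens lam h p₀ G U z.2 z.1) :=
    S.measurable_charDens.ennreal_ofReal
  have hae := S.ae_weakIntegrand hφ f hF hh
  have hmm := S.continuous_charMap.measurable
  have hq' : ∀ z : ℝ × ℝ, (ENNReal.ofReal (charDens lam h p₀ G U z.2 z.1)).toReal
      = charDens lam h p₀ G U z.2 z.1 := fun z =>
    ENNReal.toReal_ofReal (LagrangianSolution.charDens_nonneg _ _)
  have hint : Integrable W := by
    rw [← S.map_charMap, integrable_map_measure hWm.aestronglyMeasurable hmm.aemeasurable,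
      integrable_withDensity_iff_integrable_smul' hq (by simp)]
    refine (S.integrable_lagIntegrand hφ).congr ?_
    filter_upwards [hae] with z hz
    rw [hq', smul_eq_mul, ← hz]; rfl
  refine ⟨hint.integrableOn, ?_⟩
  rw [setIntegral_eq_integral_of_forall_compl_eq_zero, ← S.map_charMap,
    integral_map hmm.aemeasurable hWm.aestronglyMeasurable,
    integral_withDensity_eq_integral_toReal_smul hq (by simp)]
  · refine (integral_congr_ae ?_).trans (S.integral_lagIntegrand hφ)
    filter_upwards [hae] with z hz
    rw [hq', smul_eq_mul, ← hz]
  · intro z hz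
    have hz' : z ∉ tsupport φ := fun h => hz (hφ.2.2 h)
    rw [hW, weakIntegrand, hφ.deriv_time, hφ.deriv_space, IsTestFunction.fderiv_eq_zero hz',
      image_eq_zero_of_notMem_tsupport hz']
    simp

end ProperSolution

/-! ### Fans prevent the collapse of characteristics. -/

/-- Here `j` and `j'` are the scaled histories of a fan label and of an ordinary label, and `a` is
the initial stretch of the latter. If `a + b * j'` is small, then |j'|, hence |j|, is nearly at
least `a`; so the sum of absolute values is at least `a - δ`. Convexity of the r-th power costs
2^(1-r), and its derivative on `[0, 1]` turns δ into r δ. -/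
lemma le_abs_rpow_add_abs_rpow {r a b j j' δ : ℝ} (hr : 2 ≤ r) (ha : 0 ≤ a) (ha1 : a ≤ 1)
    (hb : |b| ≤ 1) (hj : |j - j'| ≤ δ) :
    2 ^ (1 - r) * (a ^ r - r * δ) ≤ |j| ^ r + |a + b * j'| ^ r := by
  have hδ : 0 ≤ δ := (abs_nonneg _).trans hj
  set y := |j| + |a + b * j'| with hy
  have hy0 : 0 ≤ y := by positivity
  have hya : a - δ ≤ y := by
    have h1 : a ≤ |a + b * j'| + |b * j'| := by
      have := abs_sub (a + b * j') (b * j')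
      rw [add_sub_cancel_right, abs_of_nonneg ha] at this
      exact this
    have h2 : |b * j'| ≤ |j'| := by
      rw [abs_mul]; exact mul_le_of_le_one_left (abs_nonneg _) hb
    have h3 : |j'| ≤ |j| + δ := by
      have := abs_sub_abs_le_abs_sub j' j
      rw [abs_sub_comm] at this
      linarith
    linarith
  have h1 : a ^ r - r * δ ≤ y ^ r := by
    rcases le_total a y with h | h
    · have := Real.rpow_le_rpow ha h (by linarith : 0 ≤ r)
      have : 0 ≤ r * δ := by positivity
      linarith
    · have := (le_abs_self _).trans (abs_rpow_sub_le hr (B := 1) (a := a) (b := y)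
        (by rwa [abs_of_nonneg ha]) (by rw [abs_of_nonneg hy0]; linarith))
      rw [abs_of_nonneg ha, abs_of_nonneg hy0, Real.one_rpow, mul_one,
        abs_of_nonneg (sub_nonneg.2 h)] at this
      have : r * (a - y) ≤ r * δ := mul_le_mul_of_nonneg_left (by linarith) (by linarith)
      linarith
  have h2 : y ^ r ≤ 2 ^ (r - 1) * (|j| ^ r + |a + b * j'| ^ r) := by
    exact_mod_cast NNReal.rpow_add_le_mul_rpow_add_rpow ⟨|j|, abs_nonneg _⟩
      ⟨|a + b * j'|, abs_nonneg _⟩ (by linarith : 1 ≤ r)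
  have h3 : (2 : ℝ) ^ (1 - r) * 2 ^ (r - 1) = 1 := by
    rw [← Real.rpow_add two_pos]; simp
  calc (2 : ℝ) ^ (1 - r) * (a ^ r - r * δ)
      ≤ 2 ^ (1 - r) * (2 ^ (r - 1) * (|j| ^ r + |a + b * j'| ^ r)) := by
        gcongr; exact h1.trans h2
    _ = _ := by rw [← mul_assoc, h3, one_mul]

namespace LagrangianSolution

variable {lam L M : ℝ} {F h p₀ G : ℝ → ℝ} {U : ℝ → ℝ → ℝ}
  (S : LagrangianSolution lam L M F h p₀ G U)
include S

/-- The slope is homogeneous of degree r in (p₀, G), and (m^λ)^r = m. -/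
lemma abs_slope_le_of_le {m ξ t T : ℝ} (hm : 0 ≤ m) (hp : p₀ ξ ≤ m ^ lam) (hG : |G ξ| ≤ m ^ lam)
    (ht : |t| ≤ T) : |G ξ * signedPow (1 / lam) (stretch lam h p₀ G U ξ t)|
      ≤ m * (1 + lam * M * T) ^ (1 / lam - 1) := by
  have hr := S.two_le
  have hlam := S.lam_pos
  have hT : 0 ≤ T := (abs_nonneg _).trans ht
  have hB := S.bound_pos hT
  have hd : 0 ≤ m ^ lam := by positivity
  have h1 : |stretch lam h p₀ G U ξ t| ≤ m ^ lam * (1 + lam * M * T) := by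
    have h2 : |accum h U ξ t| ≤ M * T :=
      (S.abs_accum_le ξ t).trans (mul_le_mul_of_nonneg_left ht S.M_nonneg)
    calc |stretch lam h p₀ G U ξ t| ≤ |p₀ ξ| + |lam * G ξ * accum h U ξ t| := abs_add_le _ _
      _ ≤ m ^ lam + lam * m ^ lam * (M * T) := by
          rw [abs_of_nonneg (S.p_nonneg ξ), abs_mul, abs_mul, abs_of_pos hlam]
          gcongr
      _ = _ := by ring
  rw [abs_mul, abs_signedPow hr]
  calc |G ξ| * |stretch lam h p₀ G U ξ t| ^ (1 / lam - 1)
      ≤ m ^ lam * (m ^ lam * (1 + lam * M * T)) ^ (1 / lam - 1) := by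
        have : 0 ≤ 1 / lam - 1 := by linarith
        gcongr
    _ = m ^ lam * (m ^ lam) ^ (1 / lam - 1) * (1 + lam * M * T) ^ (1 / lam - 1) := by
        rw [Real.mul_rpow hd (by linarith)]; ring
    _ = _ := by
        rw [← Real.rpow_one_add' hd (by linarith), ← Real.rpow_mul hm]
        congr 1
        rw [show lam * (1 + (1 / lam - 1)) = 1 by field_simp; ring, Real.rpow_one]

/-- On a block consisting of a fan followed by ordinary characteristics, the length at time `t`
controls the initial length. -/
lemma le_charPos_block {m k t T v₀ : ℝ} (hm : 0 < m) (ht : |t| ≤ T)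
    (hfan : ∀ s ∈ Ioo k (k + 1 / 2), p₀ s = 0 ∧ G s = m ^ lam)
    (hord : ∀ s ∈ Ioo (k + 1 / 2) (k + 1), p₀ s ≤ m ^ lam ∧ |G s| ≤ m ^ lam) :
    2 ^ (1 - 1 / lam) * (charPos lam v₀ h p₀ G U 0 (k + 1) - charPos lam v₀ h p₀ G U 0 k
        - T * L * (1 + lam * M * T) ^ (1 / lam - 1) * m ^ 2)
      ≤ charPos lam v₀ h p₀ G U t (k + 1) - charPos lam v₀ h p₀ G U t k := by
  have hr := S.two_le
  have hlam := S.lam_pos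
  have hT : 0 ≤ T := (abs_nonneg _).trans ht
  have hB := S.bound_pos hT
  have hL := S.L_nonneg
  set Q := T * L * (1 + lam * M * T) ^ (1 / lam - 1) with hQ
  have hQ0 : 0 ≤ Q := by positivity
  set d := m ^ lam with hd
  have hd0 : 0 < d := Real.rpow_pos_of_pos hm _
  have hdr : d ^ (1 / lam) = m := by
    rw [hd, ← Real.rpow_mul hm.le, mul_one_div_cancel hlam.ne', Real.rpow_one]
  have hblk : ∀ s, s ∈ Ioo k (k + 1) → s ≠ k + 1 / 2 → p₀ s ≤ d ∧ |G s| ≤ d := by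
    intro s hs hne
    rcases lt_or_gt_of_ne hne with h1 | h1
    · obtain ⟨e1, e2⟩ := hfan s ⟨hs.1, h1⟩
      rw [e1, e2, abs_of_pos hd0]; exact ⟨hd0.le, le_rfl⟩
    · exact hord s ⟨h1, hs.2⟩
  -- Each fan label `s` is paired with the ordinary label `s + 1 / 2` of its block. Within the block
  -- U_ξ is O(m), so the two values, and then the two histories, differ by O(m).
  have hUv : ∀ s ∈ Ioo k (k + 1 / 2), ∀ τ, |τ| ≤ T →
      |U s τ - U (s + 1 / 2) τ| ≤ m * (1 + lam * M * T) ^ (1 / lam - 1) := by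
    intro s hs τ hτ
    rw [abs_sub_comm, S.sub_eq_integral τ s (s + 1 / 2)]
    have := intervalIntegral.norm_integral_le_of_norm_le_const_ae (a := s) (b := s + 1 / 2)
      (f := fun η => G η * signedPow (1 / lam) (stretch lam h p₀ G U η τ))
      (C := m * (1 + lam * M * T) ^ (1 / lam - 1)) (by
        have hne : ∀ᵐ η : ℝ, η ≠ k + 1 / 2 := by simp [ae_iff]
        filter_upwards [hne] with η hne hη
        rw [uIoc_of_le (by linarith)] at hη
        obtain ⟨e1, e2⟩ := hblk η ⟨by linarith [hs.1, hη.1], by linarith [hs.2, hη.2]⟩ hne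
        exact S.abs_slope_le_of_le hm.le e1 e2 hτ)
    rw [add_sub_cancel_left, abs_of_pos (by norm_num : (0 : ℝ) < 1 / 2)] at this
    have h0 : 0 ≤ m * (1 + lam * M * T) ^ (1 / lam - 1) := by positivity
    exact this.trans (by linarith)
  have hJ : ∀ s ∈ Ioo k (k + 1 / 2),
      |lam * accum h U s t - lam * accum h U (s + 1 / 2) t| ≤ lam * (Q * m) := by
    intro s hs
    rw [← mul_sub, abs_mul, abs_of_pos hlam]
    refine mul_le_mul_of_nonneg_left ?_ hlam.le
    have cU : ∀ η, Continuous fun τ => h (U η τ) := fun η =>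
      S.continuous_h.comp (S.cont.comp (continuous_const.prodMk continuous_id))
    rw [accum, accum, ← intervalIntegral.integral_sub ((cU s).intervalIntegrable _ _)
      ((cU _).intervalIntegrable _ _)]
    have := intervalIntegral.norm_integral_le_of_norm_le_const
      (f := fun τ => h (U s τ) - h (U (s + 1 / 2) τ)) (a := 0) (b := t)
      (C := L * (m * (1 + lam * M * T) ^ (1 / lam - 1))) (fun τ hτ => by
        have hτ' : |τ| ≤ T := by
          refine le_trans ?_ ht
          rcases le_total 0 t with h0 | h0
          · rw [uIoc_of_le h0] at hτ
            rw [abs_of_pos hτ.1, abs_of_nonneg h0]; exact hτ.2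
          · rw [uIoc_of_ge h0] at hτ
            rw [abs_of_nonpos hτ.2, abs_of_nonpos h0]; linarith [hτ.1]
        exact (S.lip _ _).trans (mul_le_mul_of_nonneg_left (hUv s hs τ hτ') hL))
    rw [sub_zero, Real.norm_eq_abs] at this
    refine this.trans ?_
    calc L * (m * (1 + lam * M * T) ^ (1 / lam - 1)) * |t|
        ≤ L * (m * (1 + lam * M * T) ^ (1 / lam - 1)) * T := by gcongr
      _ = Q * m := by rw [hQ]; ring
  have hsplit : ∀ t, charPos lam v₀ h p₀ G U t (k + 1) - charPos lam v₀ h p₀ G U t k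
      = ∫ s in k..(k + 1 / 2),
          (charDens lam h p₀ G U t s + charDens lam h p₀ G U t (s + 1 / 2)) := by
    intro t
    rw [S.charPos_sub, ← intervalIntegral.integral_add_adjacent_intervals
      (S.intervalIntegrable_charDens t k (k + 1 / 2))
      (S.intervalIntegrable_charDens t (k + 1 / 2) (k + 1)), intervalIntegral.integral_add
      (S.intervalIntegrable_charDens t k (k + 1 / 2)), intervalIntegral.integral_comp_add_right]
    · norm_num [add_assoc]
    · exact intervalIntegrable_of_bounded
        ((S.measurable_charDens_slice t).comp (measurable_id.add_const _))
        (fun ξ => S.abs_charDens_le (le_refl |t|) _) _ _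
  have hint : ∀ t, IntervalIntegrable (fun s => charDens lam h p₀ G U t s
      + charDens lam h p₀ G U t (s + 1 / 2)) volume k (k + 1 / 2) := fun t =>
    (S.intervalIntegrable_charDens t _ _).add (intervalIntegrable_of_bounded
        ((S.measurable_charDens_slice t).comp (measurable_id.add_const _))
        (fun ξ => S.abs_charDens_le (le_refl |t|) _) _ _)
  -- Dividing p₀ and G by `d = m ^ lam` extracts a factor m from every density. With δ = λ Q m the
  -- loss r δ is Q m, so the total loss is Q m².
  have hpt : ∀ s ∈ Ioo k (k + 1 / 2), 2 ^ (1 - 1 / lam) *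
      ((charDens lam h p₀ G U 0 s + charDens lam h p₀ G U 0 (s + 1 / 2)) - Q * m ^ 2)
      ≤ charDens lam h p₀ G U t s + charDens lam h p₀ G U t (s + 1 / 2) := by
    intro s hs
    obtain ⟨e1, e2⟩ := hfan s hs
    obtain ⟨e3, e4⟩ := hord (s + 1 / 2) ⟨by linarith [hs.1], by linarith [hs.2]⟩
    have key := le_abs_rpow_add_abs_rpow (r := 1 / lam) (a := p₀ (s + 1 / 2) / d)
      (b := G (s + 1 / 2) / d) hr (div_nonneg (S.p_nonneg _) hd0.le) ((div_le_one hd0).2 e3)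
      (by rw [abs_div, abs_of_pos hd0]; exact (div_le_one hd0).2 e4) (hJ s hs)
    have z1 : charDens lam h p₀ G U 0 s = 0 := by
      simp only [charDens, stretch, accum, e1, intervalIntegral.integral_same, mul_zero, add_zero,
        abs_zero]
      exact Real.zero_rpow (by linarith)
    have z2 : charDens lam h p₀ G U 0 (s + 1 / 2) = m * (p₀ (s + 1 / 2) / d) ^ (1 / lam) := by
      rw [← hdr, ← Real.mul_rpow hd0.le (div_nonneg (S.p_nonneg _) hd0.le),
        mul_div_cancel₀ _ hd0.ne']
      simp [charDens, stretch, accum, abs_of_nonneg (S.p_nonneg _)]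
    have z3 : charDens lam h p₀ G U t s = m * |lam * accum h U s t| ^ (1 / lam) := by
      rw [← hdr, ← Real.mul_rpow hd0.le (abs_nonneg _), charDens, stretch, e1, e2, zero_add,
        mul_assoc, mul_left_comm, abs_mul, abs_of_pos hd0]
    have z4 : charDens lam h p₀ G U t (s + 1 / 2) = m * |p₀ (s + 1 / 2) / d
        + G (s + 1 / 2) / d * (lam * accum h U (s + 1 / 2) t)| ^ (1 / lam) := by
      have e5 : stretch lam h p₀ G U (s + 1 / 2) t = d * (p₀ (s + 1 / 2) / d
          + G (s + 1 / 2) / d * (lam * accum h U (s + 1 / 2) t)) := by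
        rw [stretch]; field_simp
      rw [← hdr, ← Real.mul_rpow hd0.le (abs_nonneg _), charDens, e5, abs_mul, abs_of_pos hd0]
    rw [z1, z2, z3, z4, zero_add, ← mul_add]
    calc _ = m * (2 ^ (1 - 1 / lam) * ((p₀ (s + 1 / 2) / d) ^ (1 / lam)
          - 1 / lam * (lam * (Q * m)))) := by field_simp
      _ ≤ _ := mul_le_mul_of_nonneg_left key hm.le
  rw [hsplit 0, hsplit t]
  have hmono := intervalIntegral.integral_mono_on_of_le_Ioo (by linarith : k ≤ k + 1 / 2)
    (((hint 0).sub intervalIntegrable_const).const_mul (2 ^ (1 - 1 / lam))) (hint t) hpt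
  refine le_trans ?_ hmono
  rw [intervalIntegral.integral_const_mul,
    intervalIntegral.integral_sub (hint 0) intervalIntegrable_const,
    intervalIntegral.integral_const, smul_eq_mul]
  have : 0 ≤ Q * m ^ 2 := by positivity
  refine mul_le_mul_of_nonneg_left ?_ (by positivity)
  have e : (k + 1 / 2 - k) * (Q * m ^ 2) = 1 / 2 * (Q * m ^ 2) := by ring
  linarith

/-- If each block contains a fan, then characteristics escape to infinity at all times. -/
lemma exists_le_charPos (v₀ : ℝ)
    (hfan : ∀ k : ℕ, ∀ s ∈ Ioo (k : ℝ) (k + 1 / 2),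
      p₀ s = 0 ∧ G s = (1 / ((k : ℝ) + 1)) ^ lam)
    (hord : ∀ k : ℕ, ∀ s ∈ Ioo ((k : ℝ) + 1 / 2) (k + 1),
      p₀ s ≤ (1 / ((k : ℝ) + 1)) ^ lam ∧ |G s| ≤ (1 / ((k : ℝ) + 1)) ^ lam)
    (hinit : Tendsto (charPos lam v₀ h p₀ G U 0) atTop atTop) (T R : ℝ) :
    ∃ Ξ, ∀ t, |t| ≤ T → R ≤ charPos lam v₀ h p₀ G U t Ξ := by
  rcases lt_or_ge T 0 with hT | hT
  · exact ⟨0, fun t ht => absurd ((abs_nonneg t).trans ht) (not_le.2 hT)⟩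
  set Q := T * L * (1 + lam * M * T) ^ (1 / lam - 1) with hQ
  have hB := S.bound_pos hT
  have hL := S.L_nonneg
  have hQ0 : 0 ≤ Q := by positivity
  -- The losses Q m² over all blocks have a finite sum, which the unbounded initial length absorbs.
  have hsum : Summable fun k : ℕ => (1 / ((k : ℝ) + 1)) ^ 2 := by
    have := (summable_nat_add_iff 1).2 (Real.summable_one_div_nat_pow.2 one_lt_two)
    simpa using this
  set Z := ∑' k : ℕ, (1 / ((k : ℝ) + 1)) ^ 2 with hZ
  have hblock : ∀ t, |t| ≤ T → ∀ n : ℕ, 2 ^ (1 - 1 / lam) * (charPos lam v₀ h p₀ G U 0 n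
      - Q * ∑ k ∈ Finset.range n, (1 / ((k : ℝ) + 1)) ^ 2)
      ≤ charPos lam v₀ h p₀ G U t n - v₀ * t := by
    intro t ht n
    induction n with
    | zero => simp [charPos]
    | succ n ih =>
      have := S.le_charPos_block (v₀ := v₀) (m := 1 / ((n : ℝ) + 1)) (k := n) (by positivity) ht
        (hfan n) (hord n)
      rw [← hQ] at this
      rw [Finset.sum_range_succ]
      push_cast
      linarith
  set e : ℝ := 2 ^ (1 - 1 / lam) with he
  have he0 : 0 < e := Real.rpow_pos_of_pos two_pos _
  obtain ⟨n, hn⟩ := ((hinit.comp tendsto_natCast_atTop_atTop).eventually_ge_atTop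
    ((R + |v₀| * T) / e + Q * Z)).exists
  simp only [Function.comp_apply] at hn
  refine ⟨n, fun t ht => ?_⟩
  have h1 := hblock t ht n
  have h2 : ∑ k ∈ Finset.range n, (1 / ((k : ℝ) + 1)) ^ 2 ≤ Z :=
    hsum.sum_le_tsum _ fun _ _ => by positivity
  have h3 : (R + |v₀| * T) / e ≤ charPos lam v₀ h p₀ G U 0 n
      - Q * ∑ k ∈ Finset.range n, (1 / ((k : ℝ) + 1)) ^ 2 := by
    have := mul_le_mul_of_nonneg_left h2 hQ0
    linarith
  rw [div_le_iff₀ he0, mul_comm] at h3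
  have h4 : -(v₀ * t) ≤ |v₀| * T := by
    calc -(v₀ * t) ≤ |v₀ * t| := neg_le_abs _
      _ = |v₀| * |t| := abs_mul _ _
      _ ≤ |v₀| * T := by gcongr
  linarith

end LagrangianSolution

/-! ### The label line: fans and ordinary labels. -/

/-- The weight of the unit block containing `ξ`. -/
noncomputable def blockWeight (ξ : ℝ) : ℝ := 1 / ((⌊ξ⌋₊ : ℝ) + 1)

/-- The labels of the characteristics that are present initially; the others start in fans. -/
def ordinarySet : Set ℝ := {ξ | ξ < 0 ∨ 1 / 2 ≤ Int.fract ξ}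

/-- The density of the ordinary labels. -/
noncomputable def ordDens : ℝ → ℝ := ordinarySet.indicator blockWeight

/-- The amount of ordinary labels up to `ξ`. -/
noncomputable def ordLength (ξ : ℝ) : ℝ := ∫ s in (0 : ℝ)..ξ, ordDens s

lemma measurable_blockWeight : Measurable blockWeight :=
  measurable_const.div ((measurable_from_nat.comp Nat.measurable_floor).add_const 1)

lemma measurableSet_ordinarySet : MeasurableSet ordinarySet :=
  measurableSet_Iio.union (measurable_fract measurableSet_Ici)

lemma blockWeight_pos (ξ : ℝ) : 0 < blockWeight ξ := by unfold blockWeight; positivity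

lemma blockWeight_le_one (ξ : ℝ) : blockWeight ξ ≤ 1 := by
  unfold blockWeight
  rw [div_le_one (by positivity)]
  have : (0 : ℝ) ≤ ⌊ξ⌋₊ := Nat.cast_nonneg _
  linarith

/-- `Nat.floor` is 0 on negative reals, so the whole negative axis has the weight of block 0. -/
lemma blockWeight_of_neg {ξ : ℝ} (hξ : ξ < 0) : blockWeight ξ = 1 := by
  simp [blockWeight, Nat.floor_of_nonpos hξ.le]

lemma floor_eq_of_mem_Ioo {k : ℕ} {s : ℝ} (hs : s ∈ Ioo (k : ℝ) (k + 1)) : ⌊s⌋₊ = k :=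
  (Nat.floor_eq_iff ((Nat.cast_nonneg k).trans hs.1.le)).2 ⟨hs.1.le, hs.2⟩

lemma mem_ordinarySet_iff {k : ℕ} {s : ℝ} (hs : s ∈ Ioo (k : ℝ) (k + 1)) :
    s ∈ ordinarySet ↔ (k : ℝ) + 1 / 2 ≤ s := by
  have h1 : ⌊s⌋ = (k : ℤ) := Int.floor_eq_iff.2 ⟨by exact_mod_cast hs.1.le, by exact_mod_cast hs.2⟩
  have h2 : Int.fract s = s - k := by rw [Int.fract, h1]; simp
  have h3 : ¬ s < 0 := not_lt.2 ((Nat.cast_nonneg k).trans hs.1.le)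
  simp only [ordinarySet, mem_ofPred_eq, h3, false_or, h2]
  constructor <;> intro h <;> linarith

lemma measurable_ordDens : Measurable ordDens :=
  measurable_blockWeight.indicator measurableSet_ordinarySet

lemma ordDens_nonneg (ξ : ℝ) : 0 ≤ ordDens ξ :=
  indicator_nonneg (fun ξ _ => (blockWeight_pos ξ).le) ξ

lemma intervalIntegrable_ordDens (a b : ℝ) : IntervalIntegrable ordDens volume a b :=
  intervalIntegrable_of_bounded measurable_ordDens (C := 1) (fun ξ => by
    rw [abs_of_nonneg (ordDens_nonneg ξ)]
    exact indicator_le' (fun ξ _ => blockWeight_le_one ξ) (fun _ _ => zero_le_one) ξ) a b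

lemma ordLength_sub (a b : ℝ) : ordLength b - ordLength a = ∫ s in a..b, ordDens s :=
  intervalIntegral.integral_interval_sub_left (intervalIntegrable_ordDens _ _)
    (intervalIntegrable_ordDens _ _)

lemma ordLength_of_nonpos {ξ : ℝ} (hξ : ξ ≤ 0) : ordLength ξ = ξ := by
  have : ∫ η in ξ..0, ordDens η = ∫ η in ξ..0, (1 : ℝ) := by
    rw [intervalIntegral.integral_of_le hξ, intervalIntegral.integral_of_le hξ,
      integral_Ioc_eq_integral_Ioo, integral_Ioc_eq_integral_Ioo]
    refine setIntegral_congr_fun measurableSet_Ioo fun η hη => ?_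
    have hmem : η ∈ ordinarySet := Or.inl hη.2
    simp only [ordDens, indicator_of_mem hmem, blockWeight_of_neg hη.2]
  rw [ordLength, intervalIntegral.integral_symm, this]
  simp

lemma monotone_ordLength : Monotone ordLength :=
  monotone_of_primitive ordDens_nonneg ordLength_sub

lemma continuous_ordLength : Continuous ordLength :=
  continuous_of_primitive intervalIntegrable_ordDens ordLength_sub

/-- The ordinary half of block n contributes 1/(2(n+1)), and the harmonic series diverges; the
weights are square-summable but not summable by design. -/
lemma tendsto_ordLength_atTop : Tendsto ordLength atTop atTop := by
  have hblock : ∀ n : ℕ, 1 / 2 * (1 / ((n : ℝ) + 1)) ≤ ordLength (n + 1) - ordLength n := by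
    intro n
    have h1 := monotone_ordLength (by linarith : (n : ℝ) ≤ n + 1 / 2)
    have h2 := ordLength_sub (n + 1 / 2) (n + 1)
    have h3 := intervalIntegral.integral_mono_on_of_le_Ioo
      (by linarith : (n : ℝ) + 1 / 2 ≤ n + 1)
      (intervalIntegrable_const (c := 1 / ((n : ℝ) + 1)) (μ := volume))
      (intervalIntegrable_ordDens _ _) (fun s hs => by
        have hs' : s ∈ Ioo (n : ℝ) (n + 1) := ⟨by linarith [hs.1], hs.2⟩
        rw [ordDens, indicator_of_mem ((mem_ordinarySet_iff hs').2 hs.1.le), blockWeight,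
          floor_eq_of_mem_Ioo hs'])
    rw [intervalIntegral.integral_const, ← h2, smul_eq_mul] at h3
    have e : ((n : ℝ) + 1 - (n + 1 / 2)) = 1 / 2 := by ring
    rw [e] at h3
    linarith
  have hsum : ∀ n : ℕ, 1 / 2 * ∑ k ∈ Finset.range n, 1 / ((k : ℝ) + 1) ≤ ordLength n := by
    intro n
    induction n with
    | zero => simp [ordLength]
    | succ n ih =>
      rw [Finset.sum_range_succ]
      push_cast
      linarith [hblock n]
  refine tendsto_atTop_atTop_of_monotone monotone_ordLength fun b => ?_
  obtain ⟨n, hn⟩ := (Real.tendsto_sum_range_one_div_nat_succ_atTop.eventually_ge_atTop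
    (2 * b)).exists
  exact ⟨n, by linarith [hsum n]⟩

lemma tendsto_ordLength_atBot : Tendsto ordLength atBot atBot := by
  refine tendsto_id.congr' ?_
  filter_upwards [eventually_le_atBot 0] with ξ hξ
  rw [ordLength_of_nonpos hξ, id]

/-! ### Initial data in Lagrangian coordinates. -/

/-- The density of the energy of an initial slope `g`. -/
noncomputable def energyDens (lam : ℝ) (g : ℝ → ℝ) (x : ℝ) : ℝ := (1 + |g x|) ^ (1 / lam)

/-- The energy up to `x` of an initial slope `g`. -/
noncomputable def energy (lam : ℝ) (g : ℝ → ℝ) (x : ℝ) : ℝ := ∫ y in (0 : ℝ)..x, energyDens lam g y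

/-- The initial position of the characteristic with label `ξ`. -/
noncomputable def foot (lam : ℝ) (g : ℝ → ℝ) (ξ : ℝ) : ℝ := monoInv (energy lam g) (ordLength ξ)

/-- The initial stretching of the characteristics. -/
noncomputable def initStretch (lam : ℝ) (g : ℝ → ℝ) : ℝ → ℝ :=
  ordinarySet.indicator fun ξ => blockWeight ξ ^ lam * (1 / (1 + |g (foot lam g ξ)|))

/-- The slope of the initial data in Lagrangian coordinates. -/
noncomputable def initSlope (lam : ℝ) (g : ℝ → ℝ) (ξ : ℝ) : ℝ :=
  ordinarySet.indicator
      (fun ξ => blockWeight ξ ^ lam * (g (foot lam g ξ) / (1 + |g (foot lam g ξ)|))) ξ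
    + ordinarySetᶜ.indicator (fun ξ => blockWeight ξ ^ lam) ξ

/-- An initial slope on the line, vanishing on the negative half-line, of locally finite energy. -/
structure IsInitialSlope (lam : ℝ) (g : ℝ → ℝ) : Prop where
  lam_pos : 0 < lam
  lam_le : lam ≤ 1 / 2
  meas : Measurable g
  zero : ∀ x ≤ 0, g x = 0
  int : ∀ a b, IntervalIntegrable (energyDens lam g) volume a b

namespace IsInitialSlope

variable {lam : ℝ} {g : ℝ → ℝ} (I : IsInitialSlope lam g)
include I

lemma two_le : 2 ≤ 1 / lam := by
  rw [le_div_iff₀ I.lam_pos]; linarith [I.lam_le]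

lemma one_le_energyDens (x : ℝ) : 1 ≤ energyDens lam g x :=
  Real.one_le_rpow (by linarith [abs_nonneg (g x)]) (by linarith [I.two_le])

lemma measurable_energyDens : Measurable (energyDens lam g) :=
  ((measurable_const.add I.meas.abs).pow_const _)

lemma energy_sub (a b : ℝ) : energy lam g b - energy lam g a = ∫ y in a..b, energyDens lam g y :=
  intervalIntegral.integral_interval_sub_left (I.int _ _) (I.int _ _)

lemma sub_le_energy_sub {a b : ℝ} (hab : a ≤ b) : b - a ≤ energy lam g b - energy lam g a := by
  rw [I.energy_sub]
  have := intervalIntegral.integral_mono_on hab intervalIntegrable_const (I.int a b)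
    fun x _ => I.one_le_energyDens x
  simpa using this

lemma energyDens_nonneg (x : ℝ) : 0 ≤ energyDens lam g x :=
  zero_le_one.trans (I.one_le_energyDens x)

lemma monotone_energy : Monotone (energy lam g) :=
  monotone_of_primitive I.energyDens_nonneg I.energy_sub

lemma continuous_energy : Continuous (energy lam g) := continuous_of_primitive I.int I.energy_sub

omit I in
lemma energy_zero : energy lam g 0 = 0 := by simp [energy]

lemma tendsto_energy_atTop : Tendsto (energy lam g) atTop atTop := by
  refine tendsto_atTop_mono' _ ?_ tendsto_id
  filter_upwards [eventually_ge_atTop 0] with x hx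
  have := I.sub_le_energy_sub hx
  rw [energy_zero] at this
  simpa using this

lemma tendsto_energy_atBot : Tendsto (energy lam g) atBot atBot := by
  refine tendsto_atBot_mono' _ ?_ tendsto_id
  filter_upwards [eventually_le_atBot 0] with x hx
  have := I.sub_le_energy_sub hx
  rw [energy_zero] at this
  simp only [id]
  linarith

lemma monoInv_energy (x : ℝ) : monoInv (energy lam g) (energy lam g x) = x := by
  have h1 := apply_monoInv I.monotone_energy I.continuous_energy I.tendsto_energy_atTop
    I.tendsto_energy_atBot (energy lam g x)
  rcases le_total (monoInv (energy lam g) (energy lam g x)) x with h | h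
  · have := I.sub_le_energy_sub h; linarith
  · have := I.sub_le_energy_sub h; linarith

lemma measurable_monoInv_energy : Measurable (monoInv (energy lam g)) :=
  (monotone_monoInv I.monotone_energy I.continuous_energy I.tendsto_energy_atTop
    I.tendsto_energy_atBot).measurable

lemma measurable_foot : Measurable (foot lam g) :=
  I.measurable_monoInv_energy.comp continuous_ordLength.measurable

lemma energy_foot (ξ : ℝ) : energy lam g (foot lam g ξ) = ordLength ξ :=
  apply_monoInv I.monotone_energy I.continuous_energy I.tendsto_energy_atTop
    I.tendsto_energy_atBot _

lemma foot_neg {ξ : ℝ} (hξ : ξ < 0) : foot lam g ξ < 0 := by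
  rw [foot, monoInv_lt_iff I.monotone_energy I.continuous_energy I.tendsto_energy_atTop
    I.tendsto_energy_atBot, energy_zero, ordLength_of_nonpos hξ.le]
  exact hξ

lemma tendsto_foot_atTop : Tendsto (foot lam g) atTop atTop := by
  refine tendsto_atTop.2 fun R => ?_
  filter_upwards [tendsto_ordLength_atTop.eventually_ge_atTop (energy lam g R)] with ξ hξ
  exact (le_monoInv_iff I.monotone_energy I.continuous_energy I.tendsto_energy_atTop
    I.tendsto_energy_atBot).2 hξ

/-- Both integrals equal the same integral over the energy variable, since the energy at the foot of
`ξ` is `ordLength ξ`. -/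
lemma integral_comp_foot {f : ℝ → ℝ} (hf : Measurable f) (ξ : ℝ) :
    ∫ η in (0 : ℝ)..ξ, ordDens η * f (foot lam g η)
      = ∫ y in (0 : ℝ)..(foot lam g ξ), energyDens lam g y * f y := by
  have h1 := intervalIntegral_comp_mul_density ordDens_nonneg intervalIntegrable_ordDens
    ordLength_sub tendsto_ordLength_atTop tendsto_ordLength_atBot measurable_ordDens
    (hf.comp I.measurable_monoInv_energy) 0 ξ
  have h2 := intervalIntegral_comp_mul_density I.energyDens_nonneg I.int I.energy_sub
    I.tendsto_energy_atTop I.tendsto_energy_atBot I.measurable_energyDens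
    (hf.comp I.measurable_monoInv_energy) 0 (foot lam g ξ)
  simp only [Function.comp_apply, I.monoInv_energy] at h1 h2
  have h0 : ordLength 0 = 0 := ordLength_of_nonpos le_rfl
  rw [h0] at h1
  rw [h2, I.energy_foot, energy_zero, ← h1]
  rfl

omit I in
lemma one_add_abs_pos (x : ℝ) : 0 < 1 + |g x| := by positivity

omit I in
lemma blockWeight_rpow_pos (ξ : ℝ) : 0 < blockWeight ξ ^ lam :=
  Real.rpow_pos_of_pos (blockWeight_pos ξ) _

lemma blockWeight_rpow_le_one (ξ : ℝ) : blockWeight ξ ^ lam ≤ 1 :=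
  Real.rpow_le_one (blockWeight_pos ξ).le (blockWeight_le_one ξ) I.lam_pos.le

omit I in
lemma initStretch_nonneg (ξ : ℝ) : 0 ≤ initStretch lam g ξ :=
  indicator_nonneg (fun ξ _ => mul_nonneg (blockWeight_rpow_pos ξ).le (by positivity)) ξ

omit I in
lemma initStretch_le (ξ : ℝ) : initStretch lam g ξ ≤ blockWeight ξ ^ lam := by
  refine indicator_le' (g := fun ξ => blockWeight ξ ^ lam) (fun ξ _ => ?_)
    (fun ξ _ => (blockWeight_rpow_pos ξ).le) ξ
  refine mul_le_of_le_one_right (blockWeight_rpow_pos ξ).le ?_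
  rw [div_le_one (one_add_abs_pos _)]
  linarith [abs_nonneg (g (foot lam g ξ))]

omit I in
lemma abs_initSlope_le (ξ : ℝ) : |initSlope lam g ξ| ≤ blockWeight ξ ^ lam := by
  have hw := blockWeight_rpow_pos (lam := lam) ξ
  by_cases hξ : ξ ∈ ordinarySet
  · rw [initSlope, indicator_of_mem hξ, indicator_of_notMem (by simpa using hξ), add_zero, abs_mul,
      abs_of_pos hw, abs_div, abs_of_pos (one_add_abs_pos _)]
    refine mul_le_of_le_one_right hw.le ?_
    rw [div_le_one (one_add_abs_pos _)]
    linarith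
  · rw [initSlope, indicator_of_notMem hξ, indicator_of_mem hξ, zero_add, abs_of_pos hw]

lemma measurable_initStretch : Measurable (initStretch lam g) :=
  ((measurable_blockWeight.pow_const _).mul (measurable_const.div
    (measurable_const.add (I.meas.comp I.measurable_foot).abs))).indicator measurableSet_ordinarySet

lemma measurable_initSlope : Measurable (initSlope lam g) :=
  (((measurable_blockWeight.pow_const _).mul ((I.meas.comp I.measurable_foot).div
    (measurable_const.add (I.meas.comp I.measurable_foot).abs))).indicator
      measurableSet_ordinarySet).add ((measurable_blockWeight.pow_const _).indicator
        measurableSet_ordinarySet.compl)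

lemma initStretch_of_neg {ξ : ℝ} (hξ : ξ < 0) : initStretch lam g ξ = 1 := by
  have hmem : ξ ∈ ordinarySet := Or.inl hξ
  rw [initStretch, indicator_of_mem hmem, blockWeight_of_neg hξ, I.zero _ (I.foot_neg hξ).le]
  simp

lemma initSlope_of_neg {ξ : ℝ} (hξ : ξ < 0) : initSlope lam g ξ = 0 := by
  have hmem : ξ ∈ ordinarySet := Or.inl hξ
  rw [initSlope, indicator_of_mem hmem, indicator_of_notMem (by simpa using hmem),
    I.zero _ (I.foot_neg hξ).le]
  simp

/-- The right side is the ordinary label density over the energy density, formally the derivative of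
`foot`; `initStretch` is chosen to make X(0, ·) = `foot`. -/
lemma initStretch_rpow (ξ : ℝ) : |initStretch lam g ξ| ^ (1 / lam)
    = ordDens ξ * (1 / (1 + |g (foot lam g ξ)|)) ^ (1 / lam) := by
  have hr := I.two_le
  rw [abs_of_nonneg (initStretch_nonneg ξ)]
  by_cases hξ : ξ ∈ ordinarySet
  · rw [initStretch, ordDens, indicator_of_mem hξ, indicator_of_mem hξ,
      Real.mul_rpow (blockWeight_rpow_pos ξ).le (by positivity), ← Real.rpow_mul
        (blockWeight_pos ξ).le, mul_one_div_cancel I.lam_pos.ne', Real.rpow_one]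
  · rw [initStretch, ordDens, indicator_of_notMem hξ, indicator_of_notMem hξ,
      Real.zero_rpow (by linarith), zero_mul]

/-- On ordinary labels G = g p₀, so G p₀^(r-1) = g p₀^r. On fan labels G is nonzero, but p₀ = 0
makes both sides vanish. -/
lemma initSlope_mul_signedPow (ξ : ℝ) :
    initSlope lam g ξ * signedPow (1 / lam) (initStretch lam g ξ)
      = ordDens ξ * (g (foot lam g ξ) * (1 / (1 + |g (foot lam g ξ)|)) ^ (1 / lam)) := by
  have hr := I.two_le
  have hw := blockWeight_rpow_pos (lam := lam) ξ
  rw [signedPow_of_nonneg hr (initStretch_nonneg ξ)]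
  by_cases hξ : ξ ∈ ordinarySet
  · have h1 : blockWeight ξ ^ lam * (blockWeight ξ ^ lam) ^ (1 / lam - 1) = blockWeight ξ := by
      rw [← Real.rpow_one_add' hw.le (by linarith), ← Real.rpow_mul (blockWeight_pos ξ).le]
      rw [show lam * (1 + (1 / lam - 1)) = 1 by have := I.lam_pos; field_simp; ring, Real.rpow_one]
    have h2 : ∀ a : ℝ, 0 ≤ a → a * a ^ (1 / lam - 1) = a ^ (1 / lam) := fun a ha => by
      rw [← Real.rpow_one_add' ha (by linarith)]; ring_nf
    rw [initStretch, initSlope, ordDens, indicator_of_mem hξ, indicator_of_mem hξ,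
      indicator_of_mem hξ, indicator_of_notMem (by simpa using hξ), add_zero,
      Real.mul_rpow hw.le (by positivity), ← h2 _ (by positivity), div_eq_mul_one_div (g _)]
    calc _ = (blockWeight ξ ^ lam * (blockWeight ξ ^ lam) ^ (1 / lam - 1)) *
          (g (foot lam g ξ) * (1 / (1 + |g (foot lam g ξ)|)
            * (1 / (1 + |g (foot lam g ξ)|)) ^ (1 / lam - 1))) := by ring
      _ = _ := by rw [h1]
  · rw [initStretch, ordDens, indicator_of_notMem hξ, indicator_of_notMem hξ,
      Real.zero_rpow (by linarith), zero_mul, mul_zero]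

omit I in
lemma energyDens_mul (x : ℝ) : energyDens lam g x * (1 / (1 + |g x|)) ^ (1 / lam) = 1 := by
  rw [energyDens, ← Real.mul_rpow (one_add_abs_pos x).le (by positivity),
    mul_one_div_cancel (one_add_abs_pos x).ne', Real.one_rpow]

/-- Fans have zero width at time 0, so only ordinary labels contribute to the position. -/
lemma charPos_initial (v₀ : ℝ) (h : ℝ → ℝ) (U : ℝ → ℝ → ℝ) (ξ : ℝ) :
    charPos lam v₀ h (initStretch lam g) (initSlope lam g) U 0 ξ = foot lam g ξ := by
  have hm : Measurable fun x => (1 / (1 + |g x|)) ^ (1 / lam) :=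
    (measurable_const.div (measurable_const.add I.meas.abs)).pow_const _
  have := I.integral_comp_foot hm ξ
  simp only [energyDens_mul, ← I.initStretch_rpow] at this
  simp only [charPos, charDens, stretch, accum, intervalIntegral.integral_same, mul_zero, add_zero,
    zero_add, this]
  simp

lemma lagOp_initial (h : ℝ → ℝ) (U : ℝ → ℝ → ℝ) (ξ : ℝ) :
    lagOp lam h (initStretch lam g) (initSlope lam g) U ξ 0
      = ∫ y in (0 : ℝ)..(foot lam g ξ), g y := by
  have hm : Measurable fun x => g x * (1 / (1 + |g x|)) ^ (1 / lam) :=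
    I.meas.mul ((measurable_const.div (measurable_const.add I.meas.abs)).pow_const _)
  have := I.integral_comp_foot hm ξ
  simp only [mul_left_comm (energyDens lam g _), energyDens_mul, mul_one,
    ← I.initSlope_mul_signedPow] at this
  simp only [lagOp, stretch, accum, intervalIntegral.integral_same, mul_zero, add_zero, this]

lemma lagrangianData {L M : ℝ} {h : ℝ → ℝ} (hL : 0 ≤ L) (hlip : ∀ a b, |h a - h b| ≤ L * |a - b|)
    (hM : ∀ a, |h a| ≤ M) : LagrangianData lam L M h (initStretch lam g) (initSlope lam g) where
  lam_pos := I.lam_pos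
  lam_le := I.lam_le
  L_nonneg := hL
  lip := hlip
  bdd := hM
  meas_p := I.measurable_initStretch
  meas_G := I.measurable_initSlope
  p_nonneg := initStretch_nonneg
  p_le ξ := (initStretch_le ξ).trans (I.blockWeight_rpow_le_one ξ)
  G_le ξ := (abs_initSlope_le ξ).trans (I.blockWeight_rpow_le_one ξ)

lemma exists_properSolution {L M : ℝ} {F h : ℝ → ℝ} (hL : 0 ≤ L)
    (hlip : ∀ a b, |h a - h b| ≤ L * |a - b|) (hM : ∀ a, |h a| ≤ M) (hF : ContDiff ℝ 1 F)
    (hFh : deriv F = h) (hF0 : 0 ≤ F 0) :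
    ∃ U, ProperSolution lam L M F h (initStretch lam g) (initSlope lam g) U := by
  have D := I.lagrangianData hL hlip hM
  obtain ⟨U, hU, hfix⟩ := D.exists_solution
  have S : LagrangianSolution lam L M F h (initStretch lam g) (initSlope lam g) U :=
    { D with contDiff_F := hF, deriv_F := hFh, cont := hU, eq := hfix }
  have hw : ∀ (k : ℕ) (s : ℝ), s ∈ Ioo (k : ℝ) (k + 1) → blockWeight s = 1 / ((k : ℝ) + 1) :=
    fun k s hs => by rw [blockWeight, floor_eq_of_mem_Ioo hs]
  refine ⟨U, { S with
    F_zero := hF0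
    p_neg := fun ξ hξ => I.initStretch_of_neg hξ
    G_neg := fun ξ hξ => I.initSlope_of_neg hξ
    proper := S.exists_le_charPos (F 0) (fun k s hs => ?_) (fun k s hs => ?_) ?_ }⟩
  · have hs' : s ∈ Ioo (k : ℝ) (k + 1) := ⟨hs.1, by linarith [hs.2]⟩
    have hn : s ∉ ordinarySet := fun hmem => by
      linarith [(mem_ordinarySet_iff hs').1 hmem, hs.2]
    rw [initStretch, indicator_of_notMem hn, initSlope, indicator_of_notMem hn,
      indicator_of_mem hn, zero_add, hw k s hs']
    exact ⟨rfl, rfl⟩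
  · have hs' : s ∈ Ioo (k : ℝ) (k + 1) := ⟨by linarith [hs.1], hs.2⟩
    rw [← hw k s hs']
    exact ⟨initStretch_le s, abs_initSlope_le s⟩
  · refine I.tendsto_foot_atTop.congr fun ξ => ?_
    rw [I.charPos_initial]

end IsInitialSlope

/-! ### From the Sobolev datum to the solution. -/

lemma integrableOn_energyDens {lam : ℝ} (hlam : 0 < lam) {g : ℝ → ℝ} {s : Set ℝ}
    (hs : volume s ≠ ⊤) (hg : MemLp g (ENNReal.ofReal (1 / lam)) (volume.restrict s)) :
    IntegrableOn (energyDens lam g) s := by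
  have : IsFiniteMeasure (volume.restrict s) := ⟨by simpa using hs.lt_top⟩
  have h1 : MemLp (fun _ : ℝ => (1 : ℝ)) (ENNReal.ofReal (1 / lam)) (volume.restrict s) :=
    memLp_const 1
  have h2 : MemLp (fun x => |g x|) (ENNReal.ofReal (1 / lam)) (volume.restrict s) := hg.norm
  have h3 := (h1.add h2).integrable_norm_rpow (by simpa using hlam) ENNReal.ofReal_ne_top
  rw [ENNReal.toReal_ofReal (by positivity)] at h3
  refine h3.congr (Eventually.of_forall fun x => ?_)
  simp only [energyDens, Pi.add_apply]
  rw [Real.norm_of_nonneg (by positivity)]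

/-- The weak derivative of an element of `W^{1,p}` of the half-line may be taken Borel measurable
on the line. -/
lemma exists_initialSlope {lam : ℝ} (hlam : lam ∈ Ioc (0 : ℝ) (1 / 2)) {u₀ : ℝ → ℝ}
    (hc : ContinuousOn u₀ (Ici 0)) (hu₀ : MemW1pLoc (1 / lam) u₀) (h0 : u₀ 0 = 0) :
    ∃ g, IsInitialSlope lam g ∧ ∀ x, 0 ≤ x → u₀ x = ∫ y in (0 : ℝ)..x, g y := by
  have hr : 2 ≤ 1 / lam := by rw [le_div_iff₀ hlam.1]; linarith [hlam.2]
  obtain ⟨g₀, -, hg₀, hw⟩ := hu₀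
  have hm : AEStronglyMeasurable g₀ (volume.restrict (Ici 0)) := by
    have hU : (Ici 0 : Set ℝ) = ⋃ n : ℕ, Icc (0 : ℝ) n := by
      ext x
      simp only [mem_Ici, mem_iUnion, mem_Icc]
      exact ⟨fun hx => (exists_nat_ge x).imp fun n hn => ⟨hx, hn⟩, fun ⟨n, hn⟩ => hn.1⟩
    rw [hU, aestronglyMeasurable_iUnion_iff]
    exact fun n => (hg₀ n).aestronglyMeasurable
  -- A Borel version of the weak derivative, extended by zero to the negative axis, so that negative
  -- labels carry the rest state.
  set g : ℝ → ℝ := (Ioi 0).indicator (hm.mk g₀) with hg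
  have hgm : Measurable g := hm.stronglyMeasurable_mk.measurable.indicator measurableSet_Ioi
  have hae : ∀ᵐ x : ℝ, 0 ≤ x → g₀ x = g x := by
    have h1 := (ae_restrict_iff' measurableSet_Ici).1 hm.ae_eq_mk
    have h2 : ∀ᵐ x : ℝ, x ≠ 0 := by simp [ae_iff]
    filter_upwards [h1, h2] with x hx hx0 hx'
    rw [hg, indicator_of_mem (mem_Ioi.2 (lt_of_le_of_ne hx' (Ne.symm hx0)))]
    exact hx hx'
  have hgL : ∀ R, MemLp g (ENNReal.ofReal (1 / lam)) (volume.restrict (Icc 0 R)) := fun R =>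
    (hg₀ R).ae_eq ((ae_restrict_iff' measurableSet_Icc).2 (hae.mono fun x hx hx' => hx hx'.1))
  have hzero : ∀ x ≤ 0, g x = 0 := fun x hx => indicator_of_notMem (notMem_Ioi.2 hx) _
  have hpos : ∀ R, 0 ≤ R → IntervalIntegrable (energyDens lam g) volume 0 R := by
    intro R hR
    rw [intervalIntegrable_iff_integrableOn_Icc_of_le hR]
    exact integrableOn_energyDens hlam.1 (by simp) (hgL R)
  have hneg : ∀ R, R ≤ 0 → IntervalIntegrable (energyDens lam g) volume 0 R := by
    intro R hR
    refine (intervalIntegrable_const (c := (1 : ℝ))).congr fun x hx => ?_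
    rw [uIoc_of_ge hR] at hx
    simp [energyDens, hzero x hx.2]
  have hall : ∀ R, IntervalIntegrable (energyDens lam g) volume 0 R := fun R =>
    (le_total 0 R).elim (hpos R) (hneg R)
  refine ⟨g, ⟨hlam.1, hlam.2, hgm, hzero, fun a b => (hall a).symm.trans (hall b)⟩,
    fun x hx => ?_⟩
  have hint : ∀ R, IntegrableOn g₀ (Icc 0 R) := fun R =>
    (hg₀ R).integrable (by
      rw [← ENNReal.ofReal_one]
      exact ENNReal.ofReal_le_ofReal (by linarith))
  rw [eq_primitive_of_weakDeriv hc hint hw hx, h0, zero_add]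
  refine intervalIntegral.integral_congr_ae (hae.mono fun y hy hy' => hy ?_)
  rw [uIoc_of_le hx] at hy'
  exact hy'.1.le

theorem theorem1p1 (lam : ℝ) (hlam : lam ∈ Ioc (0 : ℝ) (1 / 2))
    (f : ℝ → ℝ) (hf : ContDiff ℝ 2 f) (hf0 : 0 ≤ deriv f 0)
    (hfLip : ∃ L : ℝ, ∀ a b : ℝ, |deriv (deriv f) a - deriv (deriv f) b| ≤ L * |a - b|)
    (hfbdd : ∃ M : ℝ, ∀ a : ℝ, |deriv (deriv f) a| ≤ M)
    (u₀ : ℝ → ℝ) (hu₀c : ContinuousOn u₀ (Ici 0)) (hu₀ : MemW1pLoc (1 / lam) u₀)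
    (hu₀z : u₀ 0 = 0) (hu₀d : HasDerivWithinAt u₀ 0 (Ici 0) 0) :
    ∃ u : ℝ → ℝ → ℝ,
      IsWeakSolution lam f u₀ u ∧
      (lam ∈ Ioc (0 : ℝ) (1 / 3) ∪ {1 / 2} → LocallyHolderQuarterPlane (1 - lam) u) := by
  obtain ⟨L, hL⟩ := hfLip
  obtain ⟨M, hM⟩ := hfbdd
  obtain ⟨g, I, hg⟩ := exists_initialSlope hlam hu₀c hu₀ hu₀z
  have hF : ContDiff ℝ 1 (deriv f) := by
    rw [show (2 : WithTop ℕ∞) = 1 + 1 by norm_num, contDiff_succ_iff_deriv] at hf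
    exact hf.2.2
  -- The Lipschitz constant is given without a sign, hence |L|.
  obtain ⟨U, S⟩ := I.exists_properSolution (L := |L|) (abs_nonneg L)
    (fun a b => (hL a b).trans (mul_le_mul_of_nonneg_right (le_abs_self L) (abs_nonneg _)))
    hM hF rfl hf0
  -- At time 0 the position of a label is its foot and its value is the primitive of `g` up to that
  -- foot; the label selected for `x` has foot `x`.
  have hinit : ∀ x, 0 ≤ x → eulerian lam (deriv f 0) (deriv (deriv f)) (initStretch lam g)
      (initSlope lam g) U x 0 = u₀ x := by
    intro x hx
    have h1 := S.charPos_charLabel 0 x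
    rw [I.charPos_initial] at h1
    rw [eulerian, S.eq, I.lagOp_initial, h1, hg x hx]
  refine ⟨eulerian lam (deriv f 0) (deriv (deriv f)) (initStretch lam g) (initSlope lam g) U,
    ⟨S.continuousOn_eulerian, fun t ht => S.eulerian_zero ht, hinit,
      ⟨S.eulerian_zero le_rfl, hu₀d.congr hinit (hinit 0 le_rfl)⟩,
      fun t ht => ⟨_, S.isW1pLocDeriv_eulerian ht⟩, fun t ht => S.holderOnWith_slice ht,
      ⟨_, S.measurable_eulerianDeriv.aestronglyMeasurable,
        fun t ht => S.isW1pLocDeriv_eulerian ht.le,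
        fun φ hφ => S.weak_equation hφ f rfl rfl⟩⟩, fun _ => S.holderOnWith⟩
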